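/- Let $v:\mathbb R^3\to\mathbb R^3$ be a $C^1$ vector field, $2\pi$-periodic in each coordinate, divergence-free and of zero mean over the cell $[0,2\pi]^3$, whose vorticity has an absolutely convergent Fourier series, $$\nabla\times v(a)=\sum_{p\in\mathbb Z^3}\widehat\omega_p\,e^{ip\cdot a},\qquad \Gamma:=\sum_{p}|\widehat\omega_p|<\infty .$$ Cauchy's Lagrangian equations of ideal incompressible flow for the particle positions $x(a,t)=a+\xi(a,t)$ are $$\sum_{k=1}^3\nabla\dot x_k\times\nabla x_k=\nabla\times v,\qquad \det(\nabla x)=1,\qquad x(a,0)=a,\quad \dot x(a,0)=v(a).$$ Inserting $\xi(a,t)=\sum_{s\ge1}\xi^{(s)}(a)t^s$ in them and gathering the terms with $t^s$ gives, for every $s\ge1$, $$\nabla\times\xi^{(s)}=\delta^s_1\,\nabla\times v-\sum_{0<m<s}\ \sum_{k=1}^3\frac ms\,\nabla\xi^{(m)}_k\times\nabla\xi^{(s-m)}_k,$$ $$\nabla\cdot\xi^{(s)}=\sum_{0<m<s}\ \sum_{i<j}\Big((\nabla_j\xi^{(m)}_i)\nabla_i\xi^{(s-m)}_j-(\nabla_i\xi^{(m)}_i)\nabla_j\xi^{(s-m)}_j\Big)-\sum_{l+m+n=s}\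 \sum_{i,j,k}\varepsilon_{ijk}(\nabla_i\xi^{(l)}_1)(\nabla_j\xi^{(m)}_2)\nabla_k\xi^{(n)}_3,$$ with $l,m,n\ge1$. Put $$\widetilde T_c=1+\sqrt2-\sqrt{13/3},\qquad T_c=\frac{8-5\sqrt2}{3},\qquad \widetilde t_c=\widetilde T_c/\Gamma$$ ($\widetilde t_c=\infty$ if $\Gamma=0$). Then: 1. There is exactly one sequence $(\xi^{(s)})_{s\ge1}$ of $2\pi$-periodic $C^1$ vector fields of zero mean satisfying these relations; each has an absolutely convergent Fourier series $\xi^{(s)}(a)=\sum_p\widehat\xi^{(s)}_p e^{ip\cdot a}$. 2. For every $a$, the time-Taylor series $\sum_{s\ge1}\xi^{(s)}(a)t^s$ (in complex time $t$) has radius of convergence at least $\widetilde t_c$; moreover $\sum_{s\ge1}\sum_p|p|\,|\widehat\xi^{(s)}_p|\,t^s<\infty$ for $0\le t<\widetilde t_c$. 3. For real $|t|<\widetilde t_c$ the map $x(a,t)=a+\sum_{s\ge1}\xi^{(s)}(a)t^s$ is a classical solution of Cauchy's Lagrangian equations, with $x(\cdot,t)$ and $\dot x(\cdot,t)$ of class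 $C^1$ and $x(a,t)-a$ periodic and of zero mean. 4. $\widetilde T_c+\big(\tfrac12-\tfrac1{\sqrt2}\big)\widetilde T_c^{\,2}=T_c$, and the bound $\widetilde t_c$ improves the bound $T_c/\Gamma$ by about $7\%$: $|\widetilde T_c-0.3325|<5\cdot10^{-5}$, $|T_c-0.3096|<5\cdot10^{-5}$, $|\widetilde T_c/T_c-1.07|<0.005$. -/

import Mathlib

open scoped BigOperators

noncomputable section

namespace LagrangianEuler

/-- Real three-dimensional Euclidean space. -/
abbrev E3 := EuclideanSpace ℝ (Fin 3)

/-- Complex three-dimensional space with the Hermitian norm. -/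
abbrev C3 := EuclideanSpace ℂ (Fin 3)

/-- Wave vectors `p ∈ ℤ³`. -/
abbrev Wave := Fin 3 → ℤ

/-- The Euclidean length `|p|` of a wave vector. -/
def Wave.length (p : Wave) : ℝ := Real.sqrt (∑ i, (p i : ℝ) ^ 2)

/-- A real vector seen as a complex vector. -/
def complexify (u : E3) : C3 := WithLp.toLp 2 (fun i => (u i : ℂ))

/-- The matrix of first partial derivatives, with entry `(i, j)` equal to `∂ᵢ uⱼ`. -/
def jac (u : E3 → E3) (a : E3) : Matrix (Fin 3) (Fin 3) ℝ :=
  Matrix.of fun i j => fderiv ℝ u a (EuclideanSpace.single i 1) j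

/-- The gradient of the `k`-th component, `∇ u_k`. -/
def gradComp (u : E3 → E3) (k : Fin 3) (a : E3) : Fin 3 → ℝ := fun i => jac u a i k

/-- The curl of a vector field. -/
def curl (u : E3 → E3) (a : E3) : E3 :=
  !₂[jac u a 1 2 - jac u a 2 1, jac u a 2 0 - jac u a 0 2, jac u a 0 1 - jac u a 1 0]

/-- The divergence of a vector field. -/
def divergence (u : E3 → E3) (a : E3) : ℝ := ∑ i, jac u a i i

/-- `∑ₖ ∇u_k × ∇w_k`. -/
def gradCross (u w : E3 → E3) (a : E3) : E3 :=
  WithLp.toLp 2 (∑ k, crossProduct (gradComp u k a) (gradComp w k a))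

/-- `u` is `2π`-periodic in each coordinate. -/
def IsSpacePeriodic (u : E3 → E3) : Prop :=
  ∀ (a : E3) (k : Fin 3), u (a + EuclideanSpace.single k (2 * Real.pi)) = u a

/-- The periodicity cell `[0, 2π]³`. -/
def cell : Set E3 := {a | ∀ i, a i ∈ Set.Icc 0 (2 * Real.pi)}

/-- Periodic `C¹` vector fields of zero mean over the periodicity cell. -/
structure IsPeriodicField (u : E3 → E3) : Prop where
  contDiff : ContDiff ℝ 1 u
  periodic : IsSpacePeriodic u
  mean_zero : ∫ a in cell, u a = 0

/-- Admissible initial velocities: periodic, of zero mean, solenoidal. -/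
structure IsInitialVelocity (v : E3 → E3) : Prop extends IsPeriodicField v where
  div_eq_zero : ∀ a, divergence v a = 0

/-- `f(a) = ∑_p c_p exp(i p·a)` with `∑_p |c_p| < ∞`. -/
def HasAbsFourierSeries (f : E3 → E3) (c : Wave → C3) : Prop :=
  Summable (fun p => ‖c p‖) ∧
    ∀ (a : E3) (j : Fin 3),
      HasSum (fun p : Wave => c p j * Complex.exp (Complex.I * ((∑ i, (p i : ℝ) * a i : ℝ) : ℂ)))
        ((f a j : ℝ) : ℂ)

/-- The sequence `ξ⁽¹⁾, ξ⁽²⁾, …` of time-Taylor coefficients of the Lagrangian displacement of the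
flow with initial velocity `v`: zero-mean periodic fields whose curl and divergence are those
obtained by inserting `ξ = ∑_{s ≥ 1} ξ⁽ˢ⁾ tˢ` in Cauchy's Lagrangian equations and gathering the
terms with equal powers of `t`. There is no term of order zero: `ξ⁽⁰⁾ = 0`. -/
structure IsTaylorCoefficients (v : E3 → E3) (ξ : ℕ → E3 → E3) : Prop where
  zero : ξ 0 = 0
  field : ∀ s, 1 ≤ s → IsPeriodicField (ξ s)
  curl_eq : ∀ s, 1 ≤ s → ∀ a,
    curl (ξ s) a = (if s = 1 then curl v a else 0)
      - ∑ m ∈ Finset.Ioo 0 s, ((m : ℝ) / (s : ℝ)) • gradCross (ξ m) (ξ (s - m)) a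
  div_eq : ∀ s, 1 ≤ s → ∀ a,
    divergence (ξ s) a =
      (∑ m ∈ Finset.Ioo 0 s, ∑ j : Fin 3, ∑ i ∈ Finset.Iio j,
        (jac (ξ m) a j i * jac (ξ (s - m)) a i j - jac (ξ m) a i i * jac (ξ (s - m)) a j j))
      - ∑ l ∈ Finset.Ioo 0 s, ∑ m ∈ Finset.Ioo 0 (s - l),
        Matrix.det (Matrix.of fun i : Fin 3 =>
          ![jac (ξ l) a i 0, jac (ξ m) a i 1, jac (ξ (s - l - m)) a i 2])

/-- The time-Taylor series at the Lagrangian position `a`, as a power series in complex time. -/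
def timeTaylorSeries (ξ : ℕ → E3 → E3) (a : E3) : FormalMultilinearSeries ℂ ℂ C3 :=
  fun s => ContinuousMultilinearMap.mkPiRing ℂ (Fin s) (complexify (ξ s a))

/-- The map `(t, a) ↦ a + ∑_s ξ⁽ˢ⁾(a) tˢ` defined by the time-Taylor series. -/
def lagrangianMap (ξ : ℕ → E3 → E3) (t : ℝ) (a : E3) : E3 := a + ∑' s, t ^ s • ξ s a

/-- The Lagrangian time derivative of `x`. -/
def timeDeriv (x : ℝ → E3 → E3) (t : ℝ) (a : E3) : E3 := deriv (fun τ => x τ a) t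

/-- `x` is a classical solution on the set `I` of times of Cauchy's Lagrangian equations
`∑ₖ ∇ẋ_k × ∇x_k = curl v` and `det ∇x = 1`, with `x(a, 0) = a`, `ẋ(a, 0) = v(a)` and a
space-periodic displacement of zero mean. -/
structure IsCauchySolution (v : E3 → E3) (I : Set ℝ) (x : ℝ → E3 → E3) : Prop where
  initial_position : ∀ a, x 0 a = a
  initial_velocity : ∀ a, timeDeriv x 0 a = v a
  differentiable_time : ∀ t ∈ I, ∀ a, DifferentiableAt ℝ (fun τ => x τ a) t
  displacement : ∀ t ∈ I, IsPeriodicField (fun a => x t a - a)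
  contDiff_velocity : ∀ t ∈ I, ContDiff ℝ 1 (timeDeriv x t)
  cauchy_invariants : ∀ t ∈ I, ∀ a, gradCross (timeDeriv x t) (x t) a = curl v a
  volume : ∀ t ∈ I, ∀ a, (jac (x t) a).det = 1

/-- The critical dimensionless time `T_c = (8 - 5√2)/3`. -/
def criticalTime : ℝ := (8 - 5 * Real.sqrt 2) / 3

/-- The improved critical dimensionless time `1 + √2 - √(13/3)`. -/
def improvedCriticalTime : ℝ := 1 + Real.sqrt 2 - Real.sqrt (13 / 3)

end LagrangianEuler

end

/-! A zero-mean periodic field is recovered from its curl and divergence frequency by frequency: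
`|p|²|c|² = |p × c|² + |p · c|²` for the Fourier coefficient `c` at `p`. Hence the sum of
`|p||c_p|`, an ℓ¹ norm of the gradient, is at most the ℓ¹ norm of `√(|γ_p|² + |δ_p|²)`, where `γ`
and `δ` are the Fourier coefficients of the prescribed curl and divergence. This norm is
submultiplicative on products of gradients, so the recurrence can be solved and estimated order by
order.

The constants come from symmetrising the sources. Exchanging `m` and `s - m` replaces the weight
`m/s` of the antisymmetric curl source by `(2m - s)/(2s)`, of modulus at most 1/2. In Fourier
variables the symmetrised quadratic divergence source is `½ (p × q) · (c × d)`, and the symmetrised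
cubic one is 1/6 of a product of two determinants. In quadrature the quadratic constant is `√(1/4 +
1/4) = 1/√2`, the cubic one 1/6. At order 2 only `m = 1` occurs, its weight is 0, and the constant
drops to 1/2: this is the whole gain over `T_c`.

With `T = tΓ` the generating function `G` of the majorants formally satisfies `G = T + (1/2 - 1/√2)
T² + G²/√2 + G³/6`. The curve `G - G²/√2 - G³/6` has its maximum `T_c` on the positive axis at `G =
2 - √2`, and `T + (1/2 - 1/√2) T²` reaches `T_c` at the improved critical time. Up to that time
partial sums stay below `2 - √2` by induction (`IsMajorant.sum_le`). Convergence of the gradients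
then allows termwise differentiation and Cauchy products, which turn the recurrence back into
Cauchy's equations (`gradCross_lagrangianMap`, `det_lagrangianMap`). Uniqueness is injectivity of
the div-curl operator on zero-mean fields (`IsPeriodicField.ext_curl_div`). -/

noncomputable section

open Complex Filter Topology MeasureTheory

namespace LagrangianEuler

/-! ### Fourier series of periodic functions on space, through the torus -/

section TorusFourier

/-- Normalised Haar measure on the circle, as used for multiple Fourier series in Mathlib. -/
local instance circleMeasureSpace : MeasureSpace UnitAddCircle := ⟨AddCircle.haarAddCircle⟩

local instance circleHaar : Measure.IsAddHaarMeasure (volume : Measure UnitAddCircle) :=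
  inferInstanceAs (Measure.IsAddHaarMeasure AddCircle.haarAddCircle)

local instance circleProbability : IsProbabilityMeasure (volume : Measure UnitAddCircle) :=
  inferInstanceAs (IsProbabilityMeasure AddCircle.haarAddCircle)

/-- The plane wave `exp(i p·a)`. -/
def planeWave (p : Wave) (a : E3) : ℂ :=
  Complex.exp (Complex.I * ((∑ i, (p i : ℝ) * a i : ℝ) : ℂ))

/-- The three-dimensional torus. -/
abbrev Torus := UnitAddTorus (Fin 3)

/-- The covering map from space to the torus. -/
def toTorus (a : E3) : Torus := fun i => ((a i / (2 * Real.pi) : ℝ) : UnitAddCircle)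

/-- The representative in the half-open cell of a point of the torus. -/
def torusRep (y : Torus) : E3 :=
  WithLp.toLp 2 fun i => 2 * Real.pi * (AddCircle.equivIco (1 : ℝ) 0 (y i)).1

/-- The function on the torus defined by a function in space. -/
def torusLift {F : Type*} (f : E3 → F) (y : Torus) : F := f (torusRep y)

/-- `2π`-periodicity in each coordinate. -/
def PeriodicFun {F : Type*} (f : E3 → F) : Prop :=
  ∀ (a : E3) (k : Fin 3), f (a + EuclideanSpace.single k (2 * Real.pi)) = f a

/-- The Fourier coefficient at `p` of a periodic function. -/
def fourierCoeff3 (f : E3 → ℂ) (p : Wave) : ℂ := UnitAddTorus.mFourierCoeff (torusLift f) p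

lemma two_pi_ne : (2 * Real.pi) ≠ 0 := by positivity

lemma toTorus_torusRep (y : Torus) : toTorus (torusRep y) = y := by
  funext i
  simp only [toTorus, torusRep]
  rw [mul_div_cancel_left₀ _ two_pi_ne]
  exact AddCircle.coe_equivIco

lemma toTorus_surjective : Function.Surjective toTorus := fun y => ⟨_, toTorus_torusRep y⟩

lemma toTorus_add (a b : E3) : toTorus (a + b) = toTorus a + toTorus b := by
  funext i
  simp [toTorus, add_div]

/-- Continuity on the torus can thus be tested after composition with the covering map. -/
lemma isOpenQuotientMap_toTorus : IsOpenQuotientMap toTorus := by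
  have h1 : IsOpenQuotientMap (Pi.map fun (_ : Fin 3) (x : ℝ) => (x : UnitAddCircle)) :=
    IsOpenQuotientMap.piMap fun _ => QuotientAddGroup.isOpenQuotientMap_mk
  have h2 : IsOpenQuotientMap fun a : E3 => (fun i => a i / (2 * Real.pi) : Fin 3 → ℝ) := by
    let e : E3 ≃ₜ (Fin 3 → ℝ) :=
      (EuclideanSpace.equiv (Fin 3) ℝ).toHomeomorph.trans
        (Homeomorph.smulOfNeZero ((2 * Real.pi)⁻¹) (inv_ne_zero two_pi_ne))
    have : (fun a : E3 => (fun i => a i / (2 * Real.pi) : Fin 3 → ℝ)) = e := by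
      funext a i
      simp [e, div_eq_inv_mul]
    rw [this]
    exact e.isOpenQuotientMap
  exact h1.comp h2

lemma PeriodicFun.add_int {F : Type*} {f : E3 → F} (hf : PeriodicFun f) (k : Fin 3) (n : ℤ)
    (a : E3) : f (a + EuclideanSpace.single k (2 * Real.pi * n)) = f a := by
  have hnat : ∀ (n : ℕ) (a : E3), f (a + EuclideanSpace.single k (2 * Real.pi * n)) = f a := by
    intro n
    induction n with
    | zero =>
      intro a
      congr 1
      ext i
      simp
    | succ m ih =>
      intro a
      have : a + EuclideanSpace.single k (2 * Real.pi * (m + 1 : ℕ))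
          = (a + EuclideanSpace.single k (2 * Real.pi * m))
            + EuclideanSpace.single k (2 * Real.pi) := by
        ext i
        by_cases h : i = k
        · subst h; simp; ring
        · simp [h]
      rw [this, hf, ih]
  obtain ⟨m, rfl | rfl⟩ := n.eq_nat_or_neg
  · exact_mod_cast hnat m a
  · have := hnat m (a + EuclideanSpace.single k (2 * Real.pi * ((-(m : ℤ) : ℤ) : ℝ)))
    rw [← this]
    congr 1
    ext i
    by_cases h : i = k
    · subst h; simp
    · simp [h]

lemma PeriodicFun.add_lattice {F : Type*} {f : E3 → F} (hf : PeriodicFun f) (n : Wave) (a : E3) :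
    f (a + WithLp.toLp 2 fun i => 2 * Real.pi * (n i : ℝ)) = f a := by
  have : a + (WithLp.toLp 2 fun i => 2 * Real.pi * (n i : ℝ))
      = ((a + EuclideanSpace.single 0 (2 * Real.pi * n 0))
        + EuclideanSpace.single 1 (2 * Real.pi * n 1))
        + EuclideanSpace.single 2 (2 * Real.pi * n 2) := by
    ext i
    fin_cases i <;> simp
  rw [this, hf.add_int, hf.add_int, hf.add_int]

/-- Two points with the same image differ by a vector of the period lattice. -/
lemma PeriodicFun.eq_of_toTorus_eq {F : Type*} {f : E3 → F} (hf : PeriodicFun f) {a b : E3}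
    (h : toTorus a = toTorus b) : f a = f b := by
  have : ∀ i, ∃ n : ℤ, a i - b i = 2 * Real.pi * n := by
    intro i
    have hi := congrFun h i
    simp only [toTorus] at hi
    rw [← sub_eq_zero, ← AddCircle.coe_sub, AddCircle.coe_eq_zero_iff] at hi
    obtain ⟨n, hn⟩ := hi
    refine ⟨n, ?_⟩
    have := two_pi_ne
    field_simp at hn
    simp at hn
    linarith
  choose n hn using this
  rw [← hf.add_lattice n b]
  congr 1
  ext i
  have := hn i
  simp
  linarith

lemma PeriodicFun.torusLift_toTorus {F : Type*} {f : E3 → F} (hf : PeriodicFun f) (a : E3) :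
    torusLift f (toTorus a) = f a :=
  hf.eq_of_toTorus_eq (toTorus_torusRep _)

/-- The representative `torusRep` jumps at the faces of the cell; periodicity of `f` hides the jump,
since the lift composed with the quotient map is `f` itself. -/
lemma PeriodicFun.continuous_torusLift {F : Type*} [TopologicalSpace F] {f : E3 → F}
    (hf : PeriodicFun f) (hc : Continuous f) : Continuous (torusLift f) := by
  rw [isOpenQuotientMap_toTorus.isQuotientMap.continuous_iff]
  have : torusLift f ∘ toTorus = f := funext hf.torusLift_toTorus
  rwa [this]

lemma mFourier_toTorus (p : Wave) (a : E3) :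
    UnitAddTorus.mFourier p (toTorus a) = planeWave p a := by
  simp only [UnitAddTorus.mFourier, ContinuousMap.coe_mk, toTorus, fourier_coe_apply, planeWave]
  rw [← Complex.exp_sum]
  congr 1
  push_cast
  rw [Finset.mul_sum]
  refine Finset.sum_congr rfl fun i _ => ?_
  have : (Real.pi : ℂ) ≠ 0 := by exact_mod_cast Real.pi_ne_zero
  field_simp

lemma planeWave_periodic (p : Wave) : PeriodicFun (planeWave p) := by
  intro a k
  rw [← mFourier_toTorus, ← mFourier_toTorus]
  congr 1
  funext i
  by_cases h : i = k
  · subst h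
    simp [toTorus, add_div]
  · simp [toTorus, h]

lemma norm_planeWave (p : Wave) (a : E3) : ‖planeWave p a‖ = 1 := by
  rw [planeWave, mul_comm, Complex.norm_exp_ofReal_mul_I]

lemma planeWave_add (p q : Wave) (a : E3) :
    planeWave (p + q) a = planeWave p a * planeWave q a := by
  rw [planeWave, planeWave, planeWave, ← Complex.exp_add]
  congr 1
  simp only [Pi.add_apply]
  push_cast
  simp only [add_mul, Finset.sum_add_distrib]
  ring

lemma planeWave_zero (a : E3) : planeWave 0 a = 1 := by simp [planeWave]

lemma planeWave_neg (p : Wave) (a : E3) : planeWave (-p) a = starRingEnd ℂ (planeWave p a) := by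
  rw [← mFourier_toTorus, ← mFourier_toTorus, UnitAddTorus.mFourier_neg]

lemma integral_mFourier (p : Wave) :
    ∫ y : Torus, UnitAddTorus.mFourier p y = if p = 0 then 1 else 0 := by
  have h := orthonormal_iff_ite.mp (UnitAddTorus.orthonormal_mFourier (d := Fin 3)) 0 p
  simp only [UnitAddTorus.mFourierLp, ContinuousMap.inner_toLp, UnitAddTorus.mFourier_zero] at h
  simpa [eq_comm] using h

open scoped Pointwise in
/-- The integral over the periodicity cell as an integral over the torus. -/
lemma integral_cell {F : Type*} [NormedAddCommGroup F] [NormedSpace ℝ F] {f : E3 → F}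
    (hf : PeriodicFun f) :
    ∫ a in cell, f a = (2 * Real.pi) ^ 3 • ∫ y : Torus, torusLift f y := by
  have hpos : (0 : ℝ) < 2 * Real.pi := by positivity
  rw [UnitAddTorus.integral_preimage _ (0 : Fin 3 → ℝ)]
  have h1 : ∀ x : Fin 3 → ℝ, torusLift f (fun i => (x i : UnitAddCircle))
      = f (WithLp.toLp 2 ((2 * Real.pi) • x)) := by
    intro x
    rw [← hf.torusLift_toTorus]
    congr 1
    funext i
    simp [toTorus]
  simp only [h1]
  -- Dilation by 2π carries the unit cell to the cell of side 2π and produces the Jacobian; the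
  -- half-open and closed cells differ by a null set.
  have h2 := Measure.setIntegral_comp_smul (volume : Measure (Fin 3 → ℝ))
    (fun x => f (WithLp.toLp 2 x)) {x | ∀ i, x i ∈ Set.Ioc ((0 : Fin 3 → ℝ) i) ((0 : Fin 3 → ℝ) i + 1)}
    two_pi_ne
  rw [h2]
  have h3 : (2 * Real.pi) • {x : Fin 3 → ℝ | ∀ i, x i ∈ Set.Ioc ((0 : Fin 3 → ℝ) i) ((0 : Fin 3 → ℝ) i + 1)}
      = Set.univ.pi fun _ => Set.Ioc 0 (2 * Real.pi) := by
    ext x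
    rw [Set.mem_smul_set_iff_inv_smul_mem₀ two_pi_ne]
    simp only [Set.mem_ofPred_eq, Set.mem_pi, Set.mem_univ, true_imp_iff, Pi.smul_apply, smul_eq_mul,
      Pi.zero_apply, Set.mem_Ioc, zero_add, inv_mul_le_iff₀ hpos, mul_one]
    refine forall_congr' fun i => and_congr_left fun _ => ?_
    rw [mul_pos_iff_of_pos_left (inv_pos.mpr hpos)]
  rw [h3]
  have h4 : ∫ x in Set.univ.pi fun _ => Set.Ioc 0 (2 * Real.pi), f (WithLp.toLp 2 x)
      = ∫ x in Set.Icc (fun _ : Fin 3 => (0 : ℝ)) (fun _ => 2 * Real.pi), f (WithLp.toLp 2 x) :=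
    setIntegral_congr_set (Measure.univ_pi_Ioc_ae_eq_Icc (f := fun _ : Fin 3 => (0 : ℝ))
      (g := fun _ => 2 * Real.pi))
  rw [h4]
  have h5 : cell = (MeasurableEquiv.toLp 2 (Fin 3 → ℝ)).symm ⁻¹'
      Set.Icc (fun _ : Fin 3 => (0 : ℝ)) (fun _ => 2 * Real.pi) := by
    ext a
    simp only [cell, Set.mem_ofPred_eq, Set.mem_preimage, Set.mem_Icc, Pi.le_def]
    exact forall_and
  rw [h5]
  have h6 := (EuclideanSpace.volume_preserving_symm_measurableEquiv_toLp
    (Fin 3)).setIntegral_preimage_emb (MeasurableEquiv.measurableEmbedding _)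
      (fun x => f (WithLp.toLp 2 x)) (Set.Icc (fun _ : Fin 3 => (0 : ℝ)) (fun _ => 2 * Real.pi))
  rw [← h6, smul_smul]
  have h7 : (2 * Real.pi) ^ 3 * |((2 * Real.pi) ^ Module.finrank ℝ (Fin 3 → ℝ))⁻¹| = 1 := by
    rw [abs_of_pos (by positivity)]
    simp
  rw [h7, one_smul]
  rfl

/-- Fourier coefficients of an absolutely convergent trigonometric series. -/
lemma fourierCoeff3_of_hasSum {f : E3 → ℂ} {c : Wave → ℂ} (hc : Summable fun p => ‖c p‖)
    (h : ∀ a, HasSum (fun p => c p * planeWave p a) (f a)) (p : Wave) :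
    fourierCoeff3 f p = c p := by
  have hlift : ∀ y : Torus, HasSum (fun q => c q * UnitAddTorus.mFourier q y) (torusLift f y) := by
    intro y
    have := h (torusRep y)
    simp only [← mFourier_toTorus, toTorus_torusRep] at this
    exact this
  have hterm : ∀ q : Wave, ∀ y : Torus, UnitAddTorus.mFourier (-p) y * (c q * UnitAddTorus.mFourier q y)
      = c q * UnitAddTorus.mFourier (q - p) y := by
    intro q y
    rw [sub_eq_add_neg, UnitAddTorus.mFourier_add]
    ring
  have hint : ∀ q : Wave, Integrable (fun y : Torus => c q * UnitAddTorus.mFourier (q - p) y) := by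
    intro q
    exact (Continuous.integrable_of_hasCompactSupport (by fun_prop)
      (HasCompactSupport.of_compactSpace _))
  have hnorm : ∀ q : Wave, ∀ y : Torus, ‖c q * UnitAddTorus.mFourier (q - p) y‖ = ‖c q‖ := by
    intro q y
    obtain ⟨a, rfl⟩ := toTorus_surjective y
    rw [norm_mul, mFourier_toTorus, norm_planeWave, mul_one]
  have key := integral_tsum_of_summable_integral_norm (μ := (volume : Measure Torus)) hint
    (by simp only [hnorm]; simpa using hc)
  rw [fourierCoeff3, UnitAddTorus.mFourierCoeff]
  have : ∀ y : Torus, UnitAddTorus.mFourier (-p) y • torusLift f y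
      = ∑' q, c q * UnitAddTorus.mFourier (q - p) y := by
    intro y
    rw [smul_eq_mul, ← (hlift y).tsum_eq, ← tsum_mul_left]
    exact tsum_congr fun q => hterm q y
  simp only [this]
  rw [← key]
  simp only [integral_const_mul, integral_mFourier, sub_eq_zero]
  simp

/-- A continuous periodic function with summable Fourier coefficients is the sum of its Fourier
series. -/
lemma hasSum_fourierCoeff3 {f : E3 → ℂ} (hf : PeriodicFun f) (hc : Continuous f)
    (hs : Summable (fourierCoeff3 f)) (a : E3) :
    HasSum (fun p => fourierCoeff3 f p * planeWave p a) (f a) := by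
  have := UnitAddTorus.hasSum_mFourier_series_apply_of_summable
    (f := ⟨torusLift f, hf.continuous_torusLift hc⟩) hs (toTorus a)
  simpa [mFourier_toTorus, hf.torusLift_toTorus] using! this

/-- Vanishing coefficients are summable, so the inversion formula applies. -/
lemma eq_zero_of_fourierCoeff3 {f : E3 → ℂ} (hf : PeriodicFun f) (hc : Continuous f)
    (h : ∀ p, fourierCoeff3 f p = 0) : f = 0 := by
  funext a
  have h0 : fourierCoeff3 f = 0 := funext h
  have := hasSum_fourierCoeff3 hf hc (by rw [h0]; exact summable_zero) a
  simp only [h, zero_mul] at this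
  exact this.unique hasSum_zero

lemma PeriodicFun.fderiv {f : E3 → ℂ} (hf : PeriodicFun f) (w : E3) :
    PeriodicFun fun a => fderiv ℝ f a w := by
  intro a k
  have : (fun x => f (x + EuclideanSpace.single k (2 * Real.pi))) = f := funext fun x => hf x k
  have h := fderiv_comp_add_right (𝕜 := ℝ) (f := f) (x := a) (EuclideanSpace.single k (2 * Real.pi))
  rw [this] at h
  simp only [h]

/-- Fourier coefficients of a partial derivative. -/
lemma fourierCoeff3_fderiv {f : E3 → ℂ} (hf : PeriodicFun f) (hd : ContDiff ℝ 1 f) (i : Fin 3)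
    (p : Wave) :
    fourierCoeff3 (fun a => fderiv ℝ f a (EuclideanSpace.single i 1)) p
      = Complex.I * (p i : ℂ) * fourierCoeff3 f p := by
  set w : E3 := EuclideanSpace.single i 1 with hw
  set f' : E3 → ℂ := fun a => fderiv ℝ f a w with hf'
  have hpf' : PeriodicFun f' := hf.fderiv w
  have hcf' : Continuous f' := (hd.continuous_fderiv one_ne_zero).clm_apply continuous_const
  have hcl := hf.continuous_torusLift hd.continuous
  have hcl' := hpf'.continuous_torusLift hcf'
  let m : Torus → ℂ := fun y => UnitAddTorus.mFourier (-p) y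
  have hm : Continuous m := by fun_prop
  have hmn : ∀ y, ‖m y‖ = 1 := by
    intro y
    obtain ⟨a, rfl⟩ := toTorus_surjective y
    simp only [m]
    rw [mFourier_toTorus, norm_planeWave]
  -- In place of integration by parts, the integral of `F h` is treated in two ways. Differentiation
  -- under the integral at `h = 0` gives the coefficient of the partial derivative; translation
  -- invariance of Haar measure gives `exp(i pᵢ h)` times the coefficient of `f`.
  let F : ℝ → Torus → ℂ := fun h y => m y * torusLift f (y + toTorus (h • w))
  let F' : ℝ → Torus → ℂ := fun h y => m y * torusLift f' (y + toTorus (h • w))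
  obtain ⟨B, hB⟩ : ∃ B, ∀ y, ‖torusLift f' y‖ ≤ B := by
    obtain ⟨B, hB⟩ := isCompact_univ.exists_bound_of_continuousOn hcl'.continuousOn
    exact ⟨B, fun y => hB y (Set.mem_univ _)⟩
  have hFc : ∀ h, Continuous (F h) := fun h => by
    exact hm.mul (hcl.comp (by fun_prop))
  have hF'c : ∀ h, Continuous (F' h) := fun h => by
    exact hm.mul (hcl'.comp (by fun_prop))
  have hderiv : ∀ y h, HasDerivAt (fun h => F h y) (F' h y) h := by
    intro y h
    obtain ⟨a, rfl⟩ := toTorus_surjective y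
    simp only [F, F', ← toTorus_add, hf.torusLift_toTorus, hpf'.torusLift_toTorus]
    refine HasDerivAt.const_mul _ ?_
    have h1 : HasDerivAt (fun h : ℝ => a + h • w) w h := by
      simpa using ((hasDerivAt_id h).smul_const w).const_add a
    exact ((hd.differentiable one_ne_zero).differentiableAt.hasFDerivAt.comp_hasDerivAt h h1)
  have key := (hasDerivAt_integral_of_dominated_loc_of_deriv_le (μ := (volume : Measure Torus))
    (F := F) (F' := F') (x₀ := (0 : ℝ)) (s := Set.univ) (bound := fun _ => B) univ_mem
    (Eventually.of_forall fun h => (hFc h).aestronglyMeasurable)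
    ((hFc 0).integrable_of_hasCompactSupport (HasCompactSupport.of_compactSpace _))
    (hF'c 0).aestronglyMeasurable
    (Eventually.of_forall fun y h _ => by
      simp only [F', norm_mul, hmn, one_mul]
      exact hB _)
    (integrable_const B)
    (Eventually.of_forall fun y h _ => hderiv y h)).2
  have hF : ∀ h : ℝ, ∫ y, F h y = planeWave p (h • w) * fourierCoeff3 f p := by
    intro h
    have h1 := integral_add_right_eq_self (μ := (volume : Measure Torus))
      (fun y => m y * torusLift f y) (toTorus (h • w))
    rw [fourierCoeff3, UnitAddTorus.mFourierCoeff]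
    simp only [smul_eq_mul]
    rw [show (∫ t : Torus, UnitAddTorus.mFourier (-p) t * torusLift f t)
      = ∫ y : Torus, m y * torusLift f y from rfl, ← h1, ← integral_const_mul]
    congr 1
    funext y
    obtain ⟨a, rfl⟩ := toTorus_surjective y
    simp only [F, m, ← toTorus_add, mFourier_toTorus]
    rw [← mul_assoc]
    congr 1
    have h2 : planeWave (-p) (a + h • w) = planeWave (-p) a * planeWave (-p) (h • w) := by
      rw [planeWave, planeWave, planeWave, ← Complex.exp_add]
      congr 1
      simp only [PiLp.add_apply, mul_add, Finset.sum_add_distrib]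
      push_cast
      ring
    have h3 : planeWave p (h • w) * planeWave (-p) (h • w) = 1 := by
      rw [← planeWave_add, add_neg_cancel, planeWave_zero]
    rw [h2]
    linear_combination (-planeWave (-p) a) * h3
  have h0 : ∫ y, F' 0 y = fourierCoeff3 f' p := by
    rw [fourierCoeff3, UnitAddTorus.mFourierCoeff]
    congr 1
    funext y
    have : toTorus ((0 : ℝ) • w) = 0 := by
      funext j
      simp [toTorus]
    simp only [F', this, add_zero, m, smul_eq_mul]
  rw [h0] at key
  simp only [hF] at key
  have hpw : ∀ h : ℝ, planeWave p (h • w) = Complex.exp (((h : ℝ) : ℂ) * (Complex.I * (p i : ℂ))) := by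
    intro h
    rw [planeWave]
    congr 1
    have : ∑ j, (p j : ℝ) * (h • w) j = p i * h := by
      rw [Finset.sum_eq_single i]
      · simp [hw]
      · intro j _ hj
        simp [hw, hj]
      · simp
    rw [this]
    push_cast
    ring
  simp only [hpw] at key
  have h4 : HasDerivAt (fun h : ℝ => Complex.exp ((h : ℂ) * (Complex.I * (p i : ℂ))) *
      fourierCoeff3 f p) (Complex.I * (p i : ℂ) * fourierCoeff3 f p) 0 := by
    have h5 : HasDerivAt (fun h : ℝ => (h : ℂ) * (Complex.I * (p i : ℂ)))
        (Complex.I * (p i : ℂ)) 0 := by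
      simpa using (Complex.ofRealCLM.hasDerivAt (x := (0:ℝ))).mul_const (Complex.I * (p i : ℂ))
    simpa using h5.cexp.mul_const (fourierCoeff3 f p)
  exact key.unique h4

lemma PeriodicFun.integrable_coeff {f : E3 → ℂ} (hf : PeriodicFun f) (hc : Continuous f)
    (p : Wave) : Integrable (fun y : Torus => UnitAddTorus.mFourier (-p) y • torusLift f y) := by
  refine Continuous.integrable_of_hasCompactSupport ?_ (HasCompactSupport.of_compactSpace _)
  exact (UnitAddTorus.mFourier (-p)).continuous.smul (hf.continuous_torusLift hc)

lemma fourierCoeff3_sub {f g : E3 → ℂ} (hf : PeriodicFun f) (hc : Continuous f)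
    (hg : PeriodicFun g) (hcg : Continuous g) (p : Wave) :
    fourierCoeff3 (fun a => f a - g a) p = fourierCoeff3 f p - fourierCoeff3 g p := by
  have := integral_sub (hf.integrable_coeff hc p) (hg.integrable_coeff hcg p)
  simp only [fourierCoeff3, UnitAddTorus.mFourierCoeff]
  rw [← this]
  simp only [torusLift, smul_sub]

lemma PeriodicFun.add {f g : E3 → ℂ} (hf : PeriodicFun f) (hg : PeriodicFun g) :
    PeriodicFun fun a => f a + g a := fun a k => by simp only [hf a k, hg a k]

lemma fourierCoeff3_add {f g : E3 → ℂ} (hf : PeriodicFun f) (hc : Continuous f)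
    (hg : PeriodicFun g) (hcg : Continuous g) (p : Wave) :
    fourierCoeff3 (fun a => f a + g a) p = fourierCoeff3 f p + fourierCoeff3 g p := by
  have := integral_add (hf.integrable_coeff hc p) (hg.integrable_coeff hcg p)
  simp only [fourierCoeff3, UnitAddTorus.mFourierCoeff]
  rw [← this]
  simp only [torusLift, smul_add]

lemma fourierCoeff3_zero_fun (p : Wave) : fourierCoeff3 (fun _ => 0) p = 0 := by
  simp [fourierCoeff3, UnitAddTorus.mFourierCoeff, torusLift]

end TorusFourier

/-! ### Fourier coefficients of vector fields and uniqueness in the div-curl problem -/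

section FieldCoefficients

/-- The bilinear dot product on complex vectors. -/
def cdot (x y : C3) : ℂ := ∑ i, x i * y i

/-- The bilinear cross product on complex vectors. -/
def ccross (x y : C3) : C3 :=
  !₂[x 1 * y 2 - x 2 * y 1, x 2 * y 0 - x 0 * y 2, x 0 * y 1 - x 1 * y 0]

/-- A wave vector as a complex vector. -/
def Wave.vec (p : Wave) : C3 := WithLp.toLp 2 fun i => ((p i : ℤ) : ℂ)

@[simp] lemma Wave.vec_apply (p : Wave) (i : Fin 3) : p.vec i = ((p i : ℤ) : ℂ) := rfl

lemma normSq_c3 (x : C3) : ‖x‖ ^ 2 = (‖x 0‖ ^ 2 + ‖x 1‖ ^ 2 + ‖x 2‖ ^ 2) := by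
  rw [EuclideanSpace.norm_sq_eq, Fin.sum_univ_three]

lemma Wave.norm_vec (p : Wave) : ‖p.vec‖ = p.length := by
  rw [EuclideanSpace.norm_eq, Wave.length]
  congr 1
  refine Finset.sum_congr rfl fun i _ => ?_
  rw [Wave.vec_apply, ← Complex.ofReal_intCast, Complex.norm_real, Real.norm_eq_abs, sq_abs]

lemma Wave.length_nonneg (p : Wave) : 0 ≤ p.length := Real.sqrt_nonneg _

lemma Wave.length_zero : Wave.length 0 = 0 := by simp [Wave.length]

lemma Wave.length_neg (p : Wave) : (-p).length = p.length := by simp [Wave.length]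

lemma Wave.one_le_length {p : Wave} (hp : p ≠ 0) : 1 ≤ p.length := by
  obtain ⟨i, hi⟩ := Function.ne_iff.mp hp
  rw [Wave.length, Real.one_le_sqrt]
  have h1 : (1 : ℝ) ≤ (p i : ℝ) ^ 2 := by
    have : 1 ≤ (p i) ^ 2 := by
      have : p i ≠ 0 := hi
      have := sq_pos_of_ne_zero this
      omega
    exact_mod_cast this
  exact h1.trans (Finset.single_le_sum (f := fun i => (p i : ℝ) ^ 2) (fun _ _ => sq_nonneg _)
    (Finset.mem_univ i))

/-- Lagrange's identity. For complex vectors the cross product is bilinear, so the complementary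
term must be the Hermitian product. -/
lemma norm_ccross_sq_add (x y : C3) :
    ‖ccross x y‖ ^ 2 + ‖∑ i, starRingEnd ℂ (x i) * y i‖ ^ 2 = ‖x‖ ^ 2 * ‖y‖ ^ 2 := by
  simp only [normSq_c3, Fin.sum_univ_three, Complex.sq_norm, Complex.normSq_apply, ccross]
  simp
  ring

lemma norm_ccross_le (x y : C3) : ‖ccross x y‖ ≤ ‖x‖ * ‖y‖ := by
  refine le_of_sq_le_sq ?_ (by positivity)
  nlinarith [norm_ccross_sq_add x y, sq_nonneg ‖∑ i, starRingEnd ℂ (x i) * y i‖]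

/-- Lagrange's identity with the first vector conjugated, which turns the Hermitian product into the
bilinear one. -/
lemma norm_cdot_le (x y : C3) : ‖cdot x y‖ ≤ ‖x‖ * ‖y‖ := by
  let x' : C3 := WithLp.toLp 2 fun i => starRingEnd ℂ (x i)
  have hx' : ‖x'‖ = ‖x‖ := by
    rw [EuclideanSpace.norm_eq, EuclideanSpace.norm_eq]
    simp [x']
  have h := norm_ccross_sq_add x' y
  have h2 : ∑ i, starRingEnd ℂ (x' i) * y i = cdot x y := by simp [x', cdot]
  rw [h2, hx'] at h
  refine le_of_sq_le_sq ?_ (by positivity)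
  nlinarith [sq_nonneg ‖ccross x' y‖]

/-- A wave vector is real, so the Hermitian and bilinear products with it agree. This identity gives
both uniqueness and the sharp bound in the div-curl problem. -/
lemma norm_ccross_vec_sq_add (p : Wave) (x : C3) :
    ‖ccross p.vec x‖ ^ 2 + ‖cdot p.vec x‖ ^ 2 = p.length ^ 2 * ‖x‖ ^ 2 := by
  rw [← Wave.norm_vec, ← norm_ccross_sq_add]
  simp [cdot]

/-- The vector of Fourier coefficients of a real vector field. -/
def fieldCoeff (u : E3 → E3) (p : Wave) : C3 :=
  WithLp.toLp 2 fun j => fourierCoeff3 (fun a => ((u a j : ℝ) : ℂ)) p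

/-- The `j`-th component of a real vector field as a complex function. -/
def fieldComp (u : E3 → E3) (j : Fin 3) (a : E3) : ℂ := ((u a j : ℝ) : ℂ)

lemma fieldComp_periodic {u : E3 → E3} (hu : IsSpacePeriodic u) (j : Fin 3) :
    PeriodicFun (fieldComp u j) := fun a k => by simp only [fieldComp, hu a k]

/-- The linear functional `x ↦ (x j : ℂ)`. -/
def compCLM (j : Fin 3) : E3 →L[ℝ] ℂ :=
  Complex.ofRealCLM.comp (EuclideanSpace.proj j)

lemma fieldComp_eq (u : E3 → E3) (j : Fin 3) : fieldComp u j = compCLM j ∘ u := rfl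

lemma fieldComp_contDiff {u : E3 → E3} (hu : ContDiff ℝ 1 u) (j : Fin 3) :
    ContDiff ℝ 1 (fieldComp u j) := (compCLM j).contDiff.comp hu

lemma fderiv_fieldComp_single {u : E3 → E3} (hu : ContDiff ℝ 1 u) (i j : Fin 3) (a : E3) :
    fderiv ℝ (fieldComp u j) a (EuclideanSpace.single i 1) = ((jac u a i j : ℝ) : ℂ) := by
  rw [fieldComp_eq, fderiv_comp a (compCLM j).differentiableAt
    ((hu.differentiable one_ne_zero) a), ContinuousLinearMap.fderiv]
  rfl

lemma continuous_jac {u : E3 → E3} (hu : ContDiff ℝ 1 u) (i j : Fin 3) :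
    Continuous fun a => jac u a i j := by
  have h := (hu.continuous_fderiv one_ne_zero).clm_apply
    (continuous_const (y := (EuclideanSpace.single i 1 : E3)))
  exact (EuclideanSpace.proj (𝕜 := ℝ) j).continuous.comp h

lemma jac_periodic {u : E3 → E3} (hu : ContDiff ℝ 1 u) (hp : IsSpacePeriodic u) (i j : Fin 3) :
    PeriodicFun fun a => ((jac u a i j : ℝ) : ℂ) := by
  have := (fieldComp_periodic hp j).fderiv (EuclideanSpace.single i 1)
  simpa only [fderiv_fieldComp_single hu] using this

lemma fourierCoeff3_jac {u : E3 → E3} (hu : ContDiff ℝ 1 u) (hp : IsSpacePeriodic u)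
    (i j : Fin 3) (p : Wave) :
    fourierCoeff3 (fun a => ((jac u a i j : ℝ) : ℂ)) p
      = Complex.I * (p i : ℂ) * fieldCoeff u p j := by
  have := fourierCoeff3_fderiv (fieldComp_periodic hp j) (fieldComp_contDiff hu j) i p
  simpa only [fderiv_fieldComp_single hu] using! this

lemma fourierCoeff3_jac_sub {u : E3 → E3} (hu : ContDiff ℝ 1 u) (hp : IsSpacePeriodic u)
    (i j : Fin 3) (p : Wave) :
    fourierCoeff3 (fun a => ((jac u a i j - jac u a j i : ℝ) : ℂ)) p
      = Complex.I * (p i * fieldCoeff u p j - p j * fieldCoeff u p i) := by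
  have h := fourierCoeff3_sub (jac_periodic hu hp i j)
    (Complex.continuous_ofReal.comp (continuous_jac hu i j)) (jac_periodic hu hp j i)
    (Complex.continuous_ofReal.comp (continuous_jac hu j i)) p
  push_cast
  rw [h, fourierCoeff3_jac hu hp, fourierCoeff3_jac hu hp]
  ring

lemma fourierCoeff3_divergence {u : E3 → E3} (hu : ContDiff ℝ 1 u) (hp : IsSpacePeriodic u)
    (p : Wave) :
    fourierCoeff3 (fun a => ((divergence u a : ℝ) : ℂ)) p
      = Complex.I * cdot p.vec (fieldCoeff u p) := by
  have hc := fun i => Complex.continuous_ofReal.comp (continuous_jac hu i i)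
  have h1 := fourierCoeff3_add (jac_periodic hu hp 0 0) (hc 0) (jac_periodic hu hp 1 1) (hc 1) p
  have h2 := fourierCoeff3_add ((jac_periodic hu hp 0 0).add (jac_periodic hu hp 1 1))
    ((hc 0).add (hc 1)) (jac_periodic hu hp 2 2) (hc 2) p
  rw [h1, fourierCoeff3_jac hu hp, fourierCoeff3_jac hu hp, fourierCoeff3_jac hu hp] at h2
  simp only [divergence, Fin.sum_univ_three, cdot, Wave.vec_apply]
  push_cast
  rw [h2]
  ring

lemma fieldCoeff_curl {u : E3 → E3} (hu : ContDiff ℝ 1 u) (hp : IsSpacePeriodic u) (p : Wave) :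
    fieldCoeff (curl u) p = Complex.I • ccross p.vec (fieldCoeff u p) := by
  ext j
  fin_cases j
  · simpa [fieldCoeff, curl, ccross] using fourierCoeff3_jac_sub hu hp 1 2 p
  · simpa [fieldCoeff, curl, ccross] using fourierCoeff3_jac_sub hu hp 2 0 p
  · simpa [fieldCoeff, curl, ccross] using fourierCoeff3_jac_sub hu hp 0 1 p

lemma isCompact_cell : IsCompact cell := by
  have : cell = (EuclideanSpace.equiv (Fin 3) ℝ).toHomeomorph ⁻¹'
      Set.Icc (fun _ : Fin 3 => (0 : ℝ)) (fun _ => 2 * Real.pi) := by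
    ext a
    simp only [cell, Set.mem_ofPred_eq, Set.mem_preimage, Set.mem_Icc, Pi.le_def]
    exact forall_and
  rw [this]
  exact (Homeomorph.isCompact_preimage _).mpr isCompact_Icc

lemma integral_fieldComp {u : E3 → E3} (hu : Continuous u) (j : Fin 3) :
    ∫ a in cell, fieldComp u j a = compCLM j (∫ a in cell, u a) :=
  (compCLM j).integral_comp_comm (hu.continuousOn.integrableOn_compact isCompact_cell)

/-- The coefficient at frequency 0 is the mean, up to the volume of the cell. -/
lemma integral_cell_eq_zero_iff {u : E3 → E3} (hu : Continuous u) (hp : IsSpacePeriodic u) :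
    ∫ a in cell, u a = 0 ↔ fieldCoeff u 0 = 0 := by
  have h : ∀ j, ((2 * Real.pi) ^ 3 : ℝ) • fieldCoeff u 0 j = compCLM j (∫ a in cell, u a) := by
    intro j
    rw [← integral_fieldComp hu, integral_cell (fieldComp_periodic hp j)]
    congr 1
    simp [fieldCoeff, fourierCoeff3, UnitAddTorus.mFourierCoeff, UnitAddTorus.mFourier_zero]
    rfl
  have hpos : ((2 * Real.pi) ^ 3 : ℝ) ≠ 0 := by positivity
  constructor
  · intro h0
    ext j
    have := h j
    rw [h0, map_zero, smul_eq_zero] at this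
    simpa [hpos] using this
  · intro h0
    ext j
    have := h j
    rw [h0] at this
    have : ((∫ a in cell, u a) j : ℂ) = 0 := by simpa [compCLM] using this.symm
    simpa using this

/-- A continuous periodic field with vanishing Fourier coefficients vanishes. -/
lemma eq_zero_of_fieldCoeff {u : E3 → E3} (hu : Continuous u) (hp : IsSpacePeriodic u)
    (h : ∀ p, fieldCoeff u p = 0) : u = 0 := by
  funext a
  ext j
  have := eq_zero_of_fourierCoeff3 (fieldComp_periodic hp j) ((compCLM j).continuous.comp hu)
    (fun p => by
      have := congrArg (fun x : C3 => x j) (h p)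
      exact this)
  have := congrFun this a
  simpa [fieldComp] using this

/-- A zero-mean periodic `C¹` field that is irrotational and solenoidal vanishes. -/
lemma IsPeriodicField.eq_zero {u : E3 → E3} (hu : IsPeriodicField u) (hcurl : ∀ a, curl u a = 0)
    (hdiv : ∀ a, divergence u a = 0) : u = 0 := by
  refine eq_zero_of_fieldCoeff hu.contDiff.continuous hu.periodic fun p => ?_
  by_cases hp : p = 0
  · subst hp
    exact (integral_cell_eq_zero_iff hu.contDiff.continuous hu.periodic).mp hu.mean_zero
  have h1 := fieldCoeff_curl hu.contDiff hu.periodic p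
  have h0 : fieldCoeff (curl u) p = 0 := by
    ext j
    simp [fieldCoeff, hcurl, fourierCoeff3_zero_fun]
  rw [h0] at h1
  have h1' : ccross p.vec (fieldCoeff u p) = 0 := by
    simpa using h1.symm
  have h2 := fourierCoeff3_divergence hu.contDiff hu.periodic p
  simp only [hdiv, Complex.ofReal_zero, fourierCoeff3_zero_fun] at h2
  have h2' : cdot p.vec (fieldCoeff u p) = 0 := by simpa using h2.symm
  have h3 := norm_ccross_vec_sq_add p (fieldCoeff u p)
  rw [h1', h2'] at h3
  -- Curl and divergence vanish, so `|p|²|c|² = 0` with `|p| ≥ 1`.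
  have h4 := Wave.one_le_length hp
  have : ‖fieldCoeff u p‖ ^ 2 = 0 := by
    simp at h3
    rcases h3 with h3 | h3
    · linarith
    · simp [h3]
  simpa using this

lemma jac_sub {u w : E3 → E3} (hu : ContDiff ℝ 1 u) (hw : ContDiff ℝ 1 w) (a : E3) :
    jac (u - w) a = jac u a - jac w a := by
  ext i j
  simp only [jac, Matrix.of_apply, Matrix.sub_apply]
  rw [fderiv_sub (hu.differentiable one_ne_zero a) (hw.differentiable one_ne_zero a)]
  simp

lemma IsPeriodicField.sub {u w : E3 → E3} (hu : IsPeriodicField u) (hw : IsPeriodicField w) :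
    IsPeriodicField (u - w) where
  contDiff := hu.contDiff.sub hw.contDiff
  periodic a k := by simp only [Pi.sub_apply, hu.periodic a k, hw.periodic a k]
  mean_zero := by
    have := integral_sub (μ := volume.restrict cell)
      (hu.contDiff.continuous.continuousOn.integrableOn_compact isCompact_cell)
      (hw.contDiff.continuous.continuousOn.integrableOn_compact isCompact_cell)
    simpa [hu.mean_zero, hw.mean_zero] using this

/-- Zero-mean periodic `C¹` fields are determined by curl and divergence. -/
lemma IsPeriodicField.ext_curl_div {u w : E3 → E3} (hu : IsPeriodicField u)
    (hw : IsPeriodicField w) (hcurl : ∀ a, curl u a = curl w a)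
    (hdiv : ∀ a, divergence u a = divergence w a) : u = w := by
  have hj := fun a => jac_sub hu.contDiff hw.contDiff a
  have := (hu.sub hw).eq_zero (fun a => ?_) (fun a => ?_)
  · exact sub_eq_zero.mp this
  · have h := hcurl a
    have h0 := congrArg (fun x : E3 => x 0) h
    have h1 := congrArg (fun x : E3 => x 1) h
    have h2 := congrArg (fun x : E3 => x 2) h
    simp [curl] at h0 h1 h2
    ext j
    fin_cases j <;> simp [curl, hj] <;> linarith
  · have h := hdiv a
    simp only [divergence] at h ⊢
    simp only [hj, Matrix.sub_apply, Finset.sum_sub_distrib, h, sub_self]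

/-- Vector fields with an absolutely convergent Fourier series of zero mean, whose gradient has
Fourier coefficients with sum of moduli at most `A`. -/
def Good (u : E3 → E3) (A : ℝ) : Prop :=
  ∃ c : Wave → C3, HasAbsFourierSeries u c ∧ c 0 = 0 ∧
    Summable (fun p => p.length * ‖c p‖) ∧ ∑' p, p.length * ‖c p‖ ≤ A

lemma norm_apply_le (x : C3) (j : Fin 3) : ‖x j‖ ≤ ‖x‖ := PiLp.norm_apply_le x j

lemma hasAbsFourierSeries_fieldCoeff {u : E3 → E3} (hu : Continuous u) (hp : IsSpacePeriodic u)
    (hs : Summable fun p => ‖fieldCoeff u p‖) : HasAbsFourierSeries u (fieldCoeff u) := by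
  refine ⟨hs, fun a j => ?_⟩
  exact hasSum_fourierCoeff3 (fieldComp_periodic hp j) ((compCLM j).continuous.comp hu)
    (Summable.of_norm_bounded hs fun p => norm_apply_le (fieldCoeff u p) j) a

lemma fieldCoeff_of_hasAbsFourierSeries {u : E3 → E3} {c : Wave → C3}
    (h : HasAbsFourierSeries u c) (p : Wave) : fieldCoeff u p = c p := by
  ext j
  exact fourierCoeff3_of_hasSum (c := fun p => c p j) (Summable.of_nonneg_of_le
    (fun _ => norm_nonneg _) (fun p => norm_apply_le (c p) j) h.1) (fun a => h.2 a j) p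

/-- The velocity is solenoidal, so `|p||v_p| = |ω_p|` and its gradient norm is exactly `Γ`. Absolute
convergence for `v` itself follows because `|p| ≥ 1` off zero and the mean vanishes. -/
lemma IsInitialVelocity.good {v : E3 → E3} (hv : IsInitialVelocity v) {ω : Wave → C3}
    (hω : HasAbsFourierSeries (curl v) ω) : Good v (∑' p, ‖ω p‖) := by
  have hcont := hv.contDiff.continuous
  have h0 : fieldCoeff v 0 = 0 := (integral_cell_eq_zero_iff hcont hv.periodic).mp hv.mean_zero
  have hlen : ∀ p : Wave, p.length * ‖fieldCoeff v p‖ = ‖ω p‖ := by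
    intro p
    have h1 := fieldCoeff_curl hv.contDiff hv.periodic p
    rw [fieldCoeff_of_hasAbsFourierSeries hω] at h1
    have h2 := fourierCoeff3_divergence hv.contDiff hv.periodic p
    simp only [hv.div_eq_zero, Complex.ofReal_zero, fourierCoeff3_zero_fun] at h2
    have h2' : cdot p.vec (fieldCoeff v p) = 0 := by simpa using h2.symm
    have h3 := norm_ccross_vec_sq_add p (fieldCoeff v p)
    rw [h2'] at h3
    rw [h1, norm_smul, Complex.norm_I, one_mul]
    have := p.length_nonneg
    refine (sq_eq_sq₀ (by positivity) (by positivity)).mp ?_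
    rw [mul_pow, ← h3]
    simp
  have hle : ∀ p, ‖fieldCoeff v p‖ ≤ ‖ω p‖ := by
    intro p
    rw [← hlen]
    by_cases hp : p = 0
    · subst hp; simp [h0]
    · have := Wave.one_le_length hp
      nlinarith [norm_nonneg (fieldCoeff v p)]
  refine ⟨fieldCoeff v, hasAbsFourierSeries_fieldCoeff hcont hv.periodic
    (Summable.of_nonneg_of_le (fun _ => norm_nonneg _) hle hω.1), h0, ?_, ?_⟩
  · simpa only [hlen] using hω.1
  · simp only [hlen, le_refl]

end FieldCoefficients

/-! ### Absolutely convergent sums of plane waves, their regularity and real parts -/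

section PlaneWaveSums

/-- The phase `a ↦ p·a`. -/
def phase (p : Wave) : E3 →L[ℝ] ℝ := innerSL ℝ (WithLp.toLp 2 fun i => (p i : ℝ) : E3)

lemma phase_apply (p : Wave) (a : E3) : phase p a = ∑ i, (p i : ℝ) * a i := by
  simp [phase, PiLp.inner_apply, mul_comm]

lemma phase_single (p : Wave) (k : Fin 3) : phase p (EuclideanSpace.single k 1) = p k := by
  rw [phase_apply, Finset.sum_eq_single k]
  · simp
  · intro j _ hj
    simp [hj]
  · simp

lemma norm_phase (p : Wave) : ‖phase p‖ = p.length := by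
  rw [phase, innerSL_apply_norm, EuclideanSpace.norm_eq, Wave.length]
  simp

lemma planeWave_eq (p : Wave) (a : E3) : planeWave p a = Complex.exp (Complex.I * (phase p a : ℂ)) := by
  rw [planeWave, phase_apply]

/-- The derivative of `a ↦ exp(i p·a) c`. -/
def waveDeriv (p : Wave) (c : C3) (a : E3) : E3 →L[ℝ] C3 :=
  (phase p).smulRight ((Complex.I * planeWave p a) • c)

lemma norm_waveDeriv (p : Wave) (c : C3) (a : E3) : ‖waveDeriv p c a‖ = p.length * ‖c‖ := by
  rw [waveDeriv, ContinuousLinearMap.norm_smulRight_apply, norm_phase, norm_smul, norm_mul,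
    Complex.norm_I, norm_planeWave, one_mul, one_mul]

lemma hasFDerivAt_planeWave_smul (p : Wave) (c : C3) (a : E3) :
    HasFDerivAt (fun a => planeWave p a • c) (waveDeriv p c a) a := by
  have h1 : HasFDerivAt (fun a : E3 => Complex.I * ((phase p a : ℝ) : ℂ))
      (Complex.I • Complex.ofRealCLM.comp (phase p)) a :=
    (Complex.ofRealCLM.hasFDerivAt.comp a (phase p).hasFDerivAt).const_mul Complex.I
  have h2 := h1.cexp.smul_const c
  have h3 : (fun a => planeWave p a • c)
      = fun a => Complex.exp (Complex.I * ((phase p a : ℝ) : ℂ)) • c := by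
    funext a
    rw [planeWave_eq]
  rw [h3]
  convert! h2 using 1
  ext w j
  simp [waveDeriv, planeWave_eq]
  ring

lemma continuous_planeWave (p : Wave) : Continuous (planeWave p) := by
  unfold planeWave
  fun_prop

lemma continuous_waveDeriv (p : Wave) (c : C3) : Continuous (waveDeriv p c) := by
  have : Continuous fun a : E3 => ((Complex.I * planeWave p a) • c) :=
    ((continuous_const.mul (continuous_planeWave p)).smul continuous_const)
  exact (ContinuousLinearMap.smulRightL ℝ E3 C3 (phase p)).continuous.comp this

/-- A `C¹` criterion for series of vector fields, with the derivative. -/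
lemma contDiff_one_tsum {ι E F : Type*} [NormedAddCommGroup E] [NormedSpace ℝ E]
    [NormedAddCommGroup F] [NormedSpace ℝ F] [CompleteSpace F] {f : ι → E → F}
    {f' : ι → E → E →L[ℝ] F} {b b' : ι → ℝ} (hb : Summable b) (hb' : Summable b')
    (hf : ∀ i x, HasFDerivAt (f i) (f' i x) x) (hf' : ∀ i, Continuous (f' i))
    (hfb : ∀ i x, ‖f i x‖ ≤ b i) (hfb' : ∀ i x, ‖f' i x‖ ≤ b' i) :
    ContDiff ℝ 1 (fun x => ∑' i, f i x) ∧
      ∀ x, HasFDerivAt (fun x => ∑' i, f i x) (∑' i, f' i x) x := by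
  have h : ∀ x, HasFDerivAt (fun x => ∑' i, f i x) (∑' i, f' i x) x := fun x =>
    hasFDerivAt_tsum hb' hf hfb' (x₀ := x) (Summable.of_norm_bounded hb fun i => hfb i x) x
  refine ⟨contDiff_one_iff_fderiv.mpr ⟨fun x => (h x).differentiableAt, ?_⟩, h⟩
  have : fderiv ℝ (fun x => ∑' i, f i x) = fun x => ∑' i, f' i x := funext fun x => (h x).fderiv
  rw [this]
  exact continuous_tsum hf' hb' hfb'

variable {ι : Type*}

/-- A sum of vector plane waves. -/
def expSum (P : ι → Wave) (c : ι → C3) (a : E3) : C3 := ∑' i, planeWave (P i) a • c i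

lemma norm_planeWave_smul (p : Wave) (c : C3) (a : E3) : ‖planeWave p a • c‖ = ‖c‖ := by
  rw [norm_smul, norm_planeWave, one_mul]

lemma hasSum_expSum {P : ι → Wave} {c : ι → C3} (h0 : Summable fun i => ‖c i‖) (a : E3) :
    HasSum (fun i => planeWave (P i) a • c i) (expSum P c a) :=
  (Summable.of_norm_bounded h0 fun i => (norm_planeWave_smul (P i) (c i) a).le).hasSum

lemma expSum_contDiff {P : ι → Wave} {c : ι → C3} (h0 : Summable fun i => ‖c i‖)
    (h1 : Summable fun i => (P i).length * ‖c i‖) : ContDiff ℝ 1 (expSum P c) :=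
  (contDiff_one_tsum h0 h1 (fun i x => hasFDerivAt_planeWave_smul (P i) (c i) x)
    (fun i => continuous_waveDeriv (P i) (c i)) (fun _ _ => (norm_planeWave_smul _ _ _).le)
    (fun _ _ => (norm_waveDeriv _ _ _).le)).1

lemma hasFDerivAt_expSum {P : ι → Wave} {c : ι → C3} (h0 : Summable fun i => ‖c i‖)
    (h1 : Summable fun i => (P i).length * ‖c i‖) (a : E3) :
    HasFDerivAt (expSum P c) (∑' i, waveDeriv (P i) (c i) a) a :=
  (contDiff_one_tsum h0 h1 (fun i x => hasFDerivAt_planeWave_smul (P i) (c i) x)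
    (fun i => continuous_waveDeriv (P i) (c i)) (fun _ _ => (norm_planeWave_smul _ _ _).le)
    (fun _ _ => (norm_waveDeriv _ _ _).le)).2 a

lemma hasSum_waveDeriv {P : ι → Wave} {c : ι → C3}
    (h1 : Summable fun i => (P i).length * ‖c i‖) (a : E3) :
    HasSum (fun i => waveDeriv (P i) (c i) a) (∑' i, waveDeriv (P i) (c i) a) :=
  (Summable.of_norm_bounded h1 fun i => (norm_waveDeriv (P i) (c i) a).le).hasSum

/-- Real part of a complex vector. -/
def reC3 : C3 →L[ℝ] E3 :=
  LinearMap.mkContinuous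
    { toFun := fun x => (WithLp.toLp 2 fun i => (x i).re : E3)
      map_add' := fun x y => by ext i; simp
      map_smul' := fun r x => by ext i; simp } 1 (fun x => by
        rw [one_mul, EuclideanSpace.norm_eq, EuclideanSpace.norm_eq]
        refine Real.sqrt_le_sqrt (Finset.sum_le_sum fun i _ => ?_)
        simp only [Real.norm_eq_abs, LinearMap.coe_mk, AddHom.coe_mk]
        exact pow_le_pow_left₀ (abs_nonneg _) (Complex.abs_re_le_norm _) 2)

@[simp] lemma reC3_apply (x : C3) (i : Fin 3) : reC3 x i = (x i).re := rfl

lemma norm_reC3_le : ‖reC3‖ ≤ 1 := LinearMap.mkContinuous_norm_le _ zero_le_one _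

lemma fderiv_reC3_expSum {P : ι → Wave} {c : ι → C3} (h0 : Summable fun i => ‖c i‖)
    (h1 : Summable fun i => (P i).length * ‖c i‖) (a : E3) :
    fderiv ℝ (reC3 ∘ expSum P c) a = reC3.comp (∑' i, waveDeriv (P i) (c i) a) :=
  (reC3.hasFDerivAt.comp a (hasFDerivAt_expSum h0 h1 a)).fderiv

/-- The entries of the derivative of a sum of plane waves. -/
def jacC (P : ι → Wave) (c : ι → C3) (a : E3) (k j : Fin 3) : ℂ :=
  ∑' i, Complex.I * (P i k : ℂ) * c i j * planeWave (P i) a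

lemma hasSum_jacC_aux {P : ι → Wave} {c : ι → C3}
    (h1 : Summable fun i => (P i).length * ‖c i‖) (a : E3) (k j : Fin 3) :
    HasSum (fun i => Complex.I * (P i k : ℂ) * c i j * planeWave (P i) a)
      ((∑' i, waveDeriv (P i) (c i) a) (EuclideanSpace.single k 1) j) := by
  have h := (hasSum_waveDeriv h1 a).mapL (ContinuousLinearMap.apply ℝ C3
    (EuclideanSpace.single k 1 : E3))
  have h2 := h.mapL ((EuclideanSpace.proj (𝕜 := ℂ) j).restrictScalars ℝ : C3 →L[ℝ] ℂ)
  refine h2.congr_fun fun i => ?_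
  simp [waveDeriv, phase_single]
  ring

lemma hasSum_jacC {P : ι → Wave} {c : ι → C3}
    (h1 : Summable fun i => (P i).length * ‖c i‖) (a : E3) (k j : Fin 3) :
    HasSum (fun i => Complex.I * (P i k : ℂ) * c i j * planeWave (P i) a) (jacC P c a k j) :=
  (hasSum_jacC_aux h1 a k j).summable.hasSum

lemma jac_reC3_expSum {P : ι → Wave} {c : ι → C3} (h0 : Summable fun i => ‖c i‖)
    (h1 : Summable fun i => (P i).length * ‖c i‖) (a : E3) (k j : Fin 3) :
    jac (reC3 ∘ expSum P c) a k j = (jacC P c a k j).re := by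
  rw [jacC, (hasSum_jacC_aux h1 a k j).tsum_eq, jac, Matrix.of_apply, fderiv_reC3_expSum h0 h1]
  rfl

section FourierSeries

variable {u : E3 → E3} {c : Wave → C3}

lemma HasAbsFourierSeries.expSum_apply (h : HasAbsFourierSeries u c) (a : E3) (j : Fin 3) :
    expSum id c a j = (u a j : ℂ) := by
  have h1 := (hasSum_expSum (P := id) h.1 a).mapL (EuclideanSpace.proj (𝕜 := ℂ) j)
  refine h1.unique ((h.2 a j).congr_fun fun p => ?_)
  simp [planeWave, mul_comm]

lemma HasAbsFourierSeries.eq_reC3 (h : HasAbsFourierSeries u c) : u = reC3 ∘ expSum id c := by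
  funext a
  ext j
  simp [h.expSum_apply]

lemma HasAbsFourierSeries.contDiff (h : HasAbsFourierSeries u c)
    (h1 : Summable fun p => p.length * ‖c p‖) : ContDiff ℝ 1 u := by
  rw [h.eq_reC3]
  exact reC3.contDiff.comp (expSum_contDiff (P := id) h.1 h1)

lemma HasAbsFourierSeries.periodic (h : HasAbsFourierSeries u c) : IsSpacePeriodic u := by
  intro a k
  rw [h.eq_reC3]
  simp only [Function.comp_apply, expSum]
  congr 1
  exact tsum_congr fun p => by rw [planeWave_periodic]

lemma HasAbsFourierSeries.isPeriodicField (h : HasAbsFourierSeries u c) (h0 : c 0 = 0)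
    (h1 : Summable fun p => p.length * ‖c p‖) : IsPeriodicField u where
  contDiff := h.contDiff h1
  periodic := h.periodic
  mean_zero := by
    rw [integral_cell_eq_zero_iff (h.contDiff h1).continuous h.periodic,
      fieldCoeff_of_hasAbsFourierSeries h, h0]

lemma HasAbsFourierSeries.hasSum_jac (h : HasAbsFourierSeries u c)
    (h1 : Summable fun p => p.length * ‖c p‖) (a : E3) (k j : Fin 3) :
    HasSum (fun p : Wave => Complex.I * (p k : ℂ) * c p j * planeWave p a) (jac u a k j : ℂ) := by
  have h2 := hasSum_jacC_aux (P := id) h1 a k j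
  have h3 : ((EuclideanSpace.proj (𝕜 := ℂ) j).restrictScalars ℝ : C3 →L[ℝ] ℂ) ∘ expSum id c
      = fieldComp u j := by
    funext a
    exact h.expSum_apply a j
  have h4 := ((EuclideanSpace.proj (𝕜 := ℂ) j).restrictScalars ℝ : C3 →L[ℝ] ℂ).hasFDerivAt.comp a
    (hasFDerivAt_expSum (P := id) h.1 h1 a)
  rw [h3] at h4
  have h5 := fderiv_fieldComp_single (h.contDiff h1) k j a
  rw [h4.fderiv] at h5
  rw [← h5]
  exact h2

/-- Nonzero integer vectors have length at least 1: at zero mean, the gradient norm controls the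
field itself. -/
lemma norm_le_length_mul (h0 : c 0 = 0) (p : Wave) : ‖c p‖ ≤ p.length * ‖c p‖ := by
  by_cases hp : p = 0
  · subst hp; simp [h0]
  · have := Wave.one_le_length hp
    nlinarith [norm_nonneg (c p)]

lemma Good.isPeriodicField {A : ℝ} (h : Good u A) : IsPeriodicField u := by
  obtain ⟨c, hc, h0, h1, -⟩ := h
  exact hc.isPeriodicField h0 h1

lemma Good.nonneg {A : ℝ} (h : Good u A) : 0 ≤ A := by
  obtain ⟨c, -, -, -, hA⟩ := h
  exact (tsum_nonneg fun p => mul_nonneg p.length_nonneg (norm_nonneg _)).trans hA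

lemma Good.norm_le {A : ℝ} (h : Good u A) (a : E3) : ‖u a‖ ≤ A := by
  obtain ⟨c, hc, h0, h1, hA⟩ := h
  have h2 : ‖expSum id c a‖ ≤ A := by
    refine (tsum_of_norm_bounded h1.hasSum fun p => ?_).trans hA
    rw [id, norm_planeWave_smul]
    exact norm_le_length_mul h0 p
  rw [hc.eq_reC3, Function.comp_apply]
  exact (reC3.le_of_opNorm_le norm_reC3_le _).trans (by rwa [one_mul])

lemma Good.norm_fderiv_le {A : ℝ} (h : Good u A) (a : E3) : ‖fderiv ℝ u a‖ ≤ A := by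
  obtain ⟨c, hc, h0, h1, hA⟩ := h
  have h2 : ‖∑' p : Wave, waveDeriv p (c p) a‖ ≤ A :=
    (tsum_of_norm_bounded h1.hasSum fun p => (norm_waveDeriv _ _ _).le).trans hA
  rw [hc.eq_reC3, fderiv_reC3_expSum (P := id) hc.1 h1]
  refine (ContinuousLinearMap.opNorm_comp_le _ _).trans ?_
  calc ‖reC3‖ * _ ≤ 1 * ‖∑' p : Wave, waveDeriv p (c p) a‖ := by
        gcongr
        · exact norm_reC3_le
        · exact le_rfl
    _ ≤ A := by rwa [one_mul]

end FourierSeries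

/-- Complex conjugate of a complex vector. -/
def conjC3 (x : C3) : C3 := WithLp.toLp 2 fun i => starRingEnd ℂ (x i)

@[simp] lemma conjC3_apply (x : C3) (i : Fin 3) : conjC3 x i = starRingEnd ℂ (x i) := rfl

lemma norm_conjC3 (x : C3) : ‖conjC3 x‖ = ‖x‖ := by
  rw [EuclideanSpace.norm_eq, EuclideanSpace.norm_eq]
  simp

/-- Gathering the terms of equal frequency in a sum of plane waves. -/
lemma exists_gather {P : ι → Wave} {c : ι → C3} (hz : ∀ i, P i = 0 → c i = 0)
    (h1 : Summable fun i => (P i).length * ‖c i‖) :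
    ∃ C : Wave → C3, Summable (fun p => ‖C p‖) ∧ C 0 = 0 ∧
      Summable (fun p => p.length * ‖C p‖) ∧
      ∑' p, p.length * ‖C p‖ ≤ ∑' i, (P i).length * ‖c i‖ ∧
      ∀ a, HasSum (fun p => planeWave p a • C p) (expSum P c a) := by
  have hle : ∀ i, ‖c i‖ ≤ (P i).length * ‖c i‖ := by
    intro i
    by_cases hp : P i = 0
    · simp [hz i hp]
    · have := Wave.one_le_length hp
      nlinarith [norm_nonneg (c i)]
  have h0 : Summable fun i => ‖c i‖ := Summable.of_nonneg_of_le (fun _ => norm_nonneg _) hle h1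
  let e := Equiv.sigmaFiberEquiv P
  have he : ∀ x, P (e x) = x.1 := fun x => x.2.2
  -- On a fibre `|p|` is constant, so the triangle inequality shows that gathering does not increase
  -- the weighted norm.
  let C : Wave → C3 := fun p => ∑' i : {i // P i = p}, c i
  have hs0 : Summable fun x => ‖c (e x)‖ := e.summable_iff.mpr h0
  have hs1 : Summable fun x => x.1.length * ‖c (e x)‖ := by
    have := e.summable_iff.mpr h1
    refine this.congr fun x => ?_
    simp only [Function.comp_apply, he]
  have hfib : ∀ p : Wave, Summable fun i : {i // P i = p} => ‖c i‖ := fun p => hs0.sigma_factor p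
  have hCle : ∀ p : Wave, ‖C p‖ ≤ ∑' i : {i // P i = p}, ‖c i‖ := fun p =>
    norm_tsum_le_tsum_norm (hfib p)
  have hC1le : ∀ p : Wave, p.length * ‖C p‖ ≤ ∑' i : {i // P i = p}, p.length * ‖c i‖ := by
    intro p
    rw [tsum_mul_left]
    exact mul_le_mul_of_nonneg_left (hCle p) p.length_nonneg
  have hC1s : Summable fun p => p.length * ‖C p‖ :=
    Summable.of_nonneg_of_le (fun p => mul_nonneg p.length_nonneg (norm_nonneg _)) hC1le hs1.sigma
  refine ⟨C, Summable.of_nonneg_of_le (fun _ => norm_nonneg _) hCle hs0.sigma, ?_, hC1s, ?_, ?_⟩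
  · have h2 : ∀ i : {i // P i = 0}, c i = 0 := fun i => hz i i.2
    simp [C, h2]
  · refine (hC1s.tsum_le_tsum hC1le hs1.sigma).trans (le_of_eq ?_)
    have h2 := hs1.tsum_sigma
    have h3 := e.tsum_eq fun i => (P i).length * ‖c i‖
    simp only [he] at h3
    rw [← h3, h2]
    rfl
  · intro a
    have h2 := e.hasSum_iff.mpr (hasSum_expSum (P := P) h0 a)
    refine h2.sigma fun p => ?_
    have h3 : HasSum (fun i : {i // P i = p} => c i) (C p) :=
      (Summable.of_norm (hfib p)).hasSum
    refine (h3.const_smul (planeWave p a)).congr_fun fun i => ?_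
    simp only [Function.comp_apply, he]
    rfl

/-- The Fourier coefficients of the real part of a field with Fourier coefficients `C`. -/
def reCoeff (C : Wave → C3) (p : Wave) : C3 := (1 / 2 : ℂ) • (C p + conjC3 (C (-p)))

lemma norm_reCoeff_le (C : Wave → C3) (p : Wave) :
    ‖reCoeff C p‖ ≤ 1 / 2 * (‖C p‖ + ‖C (-p)‖) := by
  rw [reCoeff, norm_smul]
  simp only [one_div, norm_inv, Complex.norm_ofNat]
  gcongr
  exact (norm_add_le _ _).trans (by rw [norm_conjC3])

/-- Conjugation sends the wave `p` to `-p`, so the real part averages `C p` with the conjugate of `C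
(-p)`. As an average it does not increase the gradient norm. -/
lemma hasSum_reCoeff {C : Wave → C3} {a : E3} {x : C3}
    (h : HasSum (fun p => planeWave p a • C p) x) (j : Fin 3) :
    HasSum (fun p => reCoeff C p j * planeWave p a) ((reC3 x j : ℝ) : ℂ) := by
  have h2 : HasSum (fun p => planeWave p a * C p j) (x j) :=
    h.mapL (EuclideanSpace.proj (𝕜 := ℂ) j)
  have h3 : HasSum (fun p => starRingEnd ℂ (planeWave (-p) a * C (-p) j)) (starRingEnd ℂ (x j)) :=
    (Equiv.neg Wave).hasSum_iff.mpr (Complex.hasSum_conj'.mpr h2)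
  have h4 := (h2.add h3).mul_left (1 / 2)
  rw [Complex.add_conj] at h4
  have h5 : (1 / 2 : ℂ) * ((2 * (x j).re : ℝ) : ℂ) = ((reC3 x j : ℝ) : ℂ) := by
    rw [reC3_apply]; push_cast; ring
  rw [h5] at h4
  refine h4.congr_fun fun p => ?_
  rw [map_mul, ← planeWave_neg, neg_neg]
  change (1 / 2 * (C p j + starRingEnd ℂ (C (-p) j))) * planeWave p a = _
  ring

/-- The real part of an absolutely convergent trigonometric series with arbitrary index set is
given by an absolutely convergent Fourier series. -/
lemma good_reC3_expSum {P : ι → Wave} {c : ι → C3} (hz : ∀ i, P i = 0 → c i = 0)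
    (h1 : Summable fun i => (P i).length * ‖c i‖) :
    Good (reC3 ∘ expSum P c) (∑' i, (P i).length * ‖c i‖) := by
  obtain ⟨C, hC0s, hC0, hC1s, hC1, hsum⟩ := exists_gather hz h1
  have hneg0 : Summable fun p => ‖C (-p)‖ := (Equiv.neg Wave).summable_iff.mpr hC0s
  have hneg1 : Summable fun p => p.length * ‖C (-p)‖ := by
    have := (Equiv.neg Wave).summable_iff.mpr hC1s
    refine this.congr fun p => ?_
    simp [Wave.length_neg]
  have hneg1t : ∑' p, p.length * ‖C (-p)‖ = ∑' p, p.length * ‖C p‖ := by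
    rw [← (Equiv.neg Wave).tsum_eq fun p => p.length * ‖C p‖]
    exact tsum_congr fun p => by simp [Wave.length_neg]
  have hD1 : ∀ p, p.length * ‖reCoeff C p‖
      ≤ 1 / 2 * (p.length * ‖C p‖ + p.length * ‖C (-p)‖) := by
    intro p
    have := mul_le_mul_of_nonneg_left (norm_reCoeff_le C p) p.length_nonneg
    linarith
  have hbd := (hC1s.add hneg1).mul_left (1 / 2)
  have hD1s : Summable fun p => p.length * ‖reCoeff C p‖ :=
    Summable.of_nonneg_of_le (fun p => mul_nonneg p.length_nonneg (norm_nonneg _)) hD1 hbd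
  refine ⟨reCoeff C, ⟨?_, fun a j => hasSum_reCoeff (hsum a) j⟩, ?_, hD1s, ?_⟩
  · exact Summable.of_nonneg_of_le (fun p => norm_nonneg _) (norm_reCoeff_le C)
      ((hC0s.add hneg0).mul_left (1 / 2))
  · ext j
    simp [reCoeff, hC0]
  · refine (hD1s.tsum_le_tsum hD1 hbd).trans ?_
    rw [tsum_mul_left, hC1s.tsum_add hneg1, hneg1t]
    linarith

end PlaneWaveSums

/-! ### Solving the div-curl system in Fourier space -/

section DivCurl

variable {ι : Type*}

/-- The solution `β` of `i p × β = γ`, `i p · β = δ`. -/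
def biotSavart (p : Wave) (γ : C3) (δ : ℂ) : C3 :=
  (((p.length ^ 2 : ℝ) : ℂ)⁻¹ * Complex.I) • (ccross p.vec γ - δ • p.vec)

lemma Wave.length_sq (p : Wave) :
    ((p.length ^ 2 : ℝ) : ℂ) = (p 0 : ℂ) * p 0 + (p 1 : ℂ) * p 1 + (p 2 : ℂ) * p 2 := by
  rw [Wave.length, Real.sq_sqrt (Finset.sum_nonneg fun _ _ => sq_nonneg _), Fin.sum_univ_three]
  push_cast
  ring

lemma Wave.length_sq_ne {p : Wave} (hp : p ≠ 0) : ((p.length ^ 2 : ℝ) : ℂ) ≠ 0 := by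
  have := Wave.one_le_length hp
  exact_mod_cast (by positivity : p.length ^ 2 ≠ 0)

/-- By `p × (p × γ) = (p · γ) p - |p|² γ`, a solution needs `γ` transverse to `p`; the part along
`p` drops out of the cross product. -/
lemma ccross_biotSavart {p : Wave} {γ : C3} {δ : ℂ} (hγ : cdot p.vec γ = 0)
    (hz : p = 0 → γ = 0) : Complex.I • ccross p.vec (biotSavart p γ δ) = γ := by
  by_cases hp : p = 0
  · rw [hz hp, hp]
    ext j
    fin_cases j <;> simp [ccross]
  have hl := Wave.length_sq_ne hp
  have hl2 := Wave.length_sq p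
  unfold biotSavart
  generalize ((p.length ^ 2 : ℝ) : ℂ) = L at hl hl2 ⊢
  have hI := Complex.I_mul_I
  simp only [cdot, Fin.sum_univ_three, Wave.vec_apply] at hγ
  have hLL : L⁻¹ * L = 1 := inv_mul_cancel₀ hl
  ext j
  fin_cases j
  · simp [ccross]
    linear_combination (L⁻¹ * (p 0 * (p 0 * γ 0 + p 1 * γ 1 + p 2 * γ 2) - L * γ 0)) * hI
      - L⁻¹ * p 0 * hγ + γ 0 * hLL + Complex.I * Complex.I * L⁻¹ * γ 0 * hl2
  · simp [ccross]
    linear_combination (L⁻¹ * (p 1 * (p 0 * γ 0 + p 1 * γ 1 + p 2 * γ 2) - L * γ 1)) * hI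
      - L⁻¹ * p 1 * hγ + γ 1 * hLL + Complex.I * Complex.I * L⁻¹ * γ 1 * hl2
  · simp [ccross]
    linear_combination (L⁻¹ * (p 2 * (p 0 * γ 0 + p 1 * γ 1 + p 2 * γ 2) - L * γ 2)) * hI
      - L⁻¹ * p 2 * hγ + γ 2 * hLL + Complex.I * Complex.I * L⁻¹ * γ 2 * hl2

lemma cdot_biotSavart {p : Wave} {γ : C3} {δ : ℂ} (hz : p = 0 → δ = 0) :
    Complex.I * cdot p.vec (biotSavart p γ δ) = δ := by
  by_cases hp : p = 0
  · rw [hz hp, hp]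
    simp [cdot]
  have hl := Wave.length_sq_ne hp
  have hl2 := Wave.length_sq p
  unfold biotSavart
  generalize ((p.length ^ 2 : ℝ) : ℂ) = L at hl hl2 ⊢
  have hI := Complex.I_mul_I
  have hLL : L⁻¹ * L = 1 := inv_mul_cancel₀ hl
  simp [cdot, Fin.sum_univ_three, ccross]
  linear_combination (- δ * L⁻¹ * (p 0 * p 0 + p 1 * p 1 + p 2 * p 2)) * hI - δ * L⁻¹ * hl2
    + δ * hLL

lemma biotSavart_zero (γ : C3) (δ : ℂ) : biotSavart 0 γ δ = 0 := by
  simp [biotSavart, Wave.length_zero]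

/-- The curl and divergence parts of the solution are orthogonal, so the sources enter in
quadrature. Adding their moduli instead would give 1 in place of `1/√2` in the quadratic bound. -/
lemma length_mul_norm_biotSavart_le {p : Wave} {γ : C3} {δ : ℂ} {b : ℝ} (hb : 0 ≤ b)
    (hγ : cdot p.vec γ = 0) (hle : ‖γ‖ ^ 2 + ‖δ‖ ^ 2 ≤ b ^ 2) :
    p.length * ‖biotSavart p γ δ‖ ≤ b := by
  by_cases hp : p = 0
  · simpa [hp, Wave.length_zero] using hb
  have h1 := ccross_biotSavart (δ := δ) hγ (fun h => absurd h hp)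
  have h2 := cdot_biotSavart (γ := γ) (δ := δ) (fun h => absurd h hp)
  have h3 := norm_ccross_vec_sq_add p (biotSavart p γ δ)
  have h1' : ‖ccross p.vec (biotSavart p γ δ)‖ = ‖γ‖ := by
    conv_rhs => rw [← h1, norm_smul, Complex.norm_I, one_mul]
  have h2' : ‖cdot p.vec (biotSavart p γ δ)‖ = ‖δ‖ := by
    conv_rhs => rw [← h2, norm_mul, Complex.norm_I, one_mul]
  rw [h1', h2'] at h3
  refine le_of_sq_le_sq ?_ hb
  rw [mul_pow, ← h3]
  exact hle

/-- Solution of the div-curl system with sources given by trigonometric series. -/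
lemma exists_good_curl_div {P : ι → Wave} {γ : ι → C3} {δ : ι → ℂ} {b : ι → ℝ}
    (hγ : ∀ i, cdot (P i).vec (γ i) = 0) (hz : ∀ i, P i = 0 → γ i = 0 ∧ δ i = 0)
    (hb : ∀ i, 0 ≤ b i) (hbs : Summable b) (hle : ∀ i, ‖γ i‖ ^ 2 + ‖δ i‖ ^ 2 ≤ b i ^ 2)
    {C : E3 → E3} {D : E3 → ℝ}
    (hC : ∀ a j, HasSum (fun i => γ i j * planeWave (P i) a) (C a j : ℂ))
    (hD : ∀ a, HasSum (fun i => δ i * planeWave (P i) a) (D a : ℂ)) :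
    ∃ u, Good u (∑' i, b i) ∧ (∀ a, curl u a = C a) ∧ ∀ a, divergence u a = D a := by
  let β : ι → C3 := fun i => biotSavart (P i) (γ i) (δ i)
  have hβ0 : ∀ i, P i = 0 → β i = 0 := fun i hi => by simp only [β, hi, biotSavart_zero]
  have hβ1 : ∀ i, (P i).length * ‖β i‖ ≤ b i := fun i =>
    length_mul_norm_biotSavart_le (hb i) (hγ i) (hle i)
  have hs1 : Summable fun i => (P i).length * ‖β i‖ :=
    Summable.of_nonneg_of_le (fun i => mul_nonneg (P i).length_nonneg (norm_nonneg _)) hβ1 hbs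
  have hs0 : Summable fun i => ‖β i‖ := by
    refine Summable.of_nonneg_of_le (fun _ => norm_nonneg _) (fun i => ?_) hs1
    by_cases hp : P i = 0
    · simp [hβ0 i hp]
    · have := Wave.one_le_length hp
      nlinarith [norm_nonneg (β i)]
  have hcr : ∀ i, Complex.I • ccross (P i).vec (β i) = γ i := fun i =>
    ccross_biotSavart (hγ i) fun h => (hz i h).1
  have hdot : ∀ i, Complex.I * cdot (P i).vec (β i) = δ i := fun i =>
    cdot_biotSavart fun h => (hz i h).2
  -- The prescribed curl and divergence are real and commute with real parts, so taking the real
  -- part of the sum avoids checking that the sum is real. The terms need not be gathered by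
  -- frequency beforehand.
  obtain ⟨c, hc, hc0, hc1, hcA⟩ := good_reC3_expSum hβ0 hs1
  refine ⟨reC3 ∘ expSum P β, ⟨c, hc, hc0, hc1, hcA.trans (hs1.tsum_le_tsum hβ1 hbs)⟩,
    fun a => ?_, fun a => ?_⟩
  · have hjac := fun k j => hasSum_jacC (P := P) (c := β) hs1 a k j
    have key : ∀ k j l, (∀ i, γ i l = Complex.I * (P i k * β i j - P i j * β i k)) →
        (jacC P β a k j).re - (jacC P β a j k).re = C a l := by
      intro k j l h
      have h1 := (hjac k j).sub (hjac j k)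
      have h2 := h1.unique ((hC a l).congr_fun fun i => by rw [h i]; ring)
      rw [← Complex.sub_re, h2, Complex.ofReal_re]
    ext l
    simp only [curl, jac_reC3_expSum hs0 hs1]
    fin_cases l
    · exact key 1 2 0 fun i => by rw [← hcr i]; simp [ccross]
    · exact key 2 0 1 fun i => by rw [← hcr i]; simp [ccross]
    · exact key 0 1 2 fun i => by rw [← hcr i]; simp [ccross]
  · have h1 := hasSum_sum (s := Finset.univ) fun k (_ : k ∈ Finset.univ) =>
      hasSum_jacC (P := P) (c := β) hs1 a k k
    have h2 := h1.unique ((hD a).congr_fun fun i => by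
      rw [← hdot i, cdot, Finset.mul_sum, Finset.sum_mul]
      refine Finset.sum_congr rfl fun k _ => ?_
      rw [Wave.vec_apply]
      ring)
    simp only [divergence, jac_reC3_expSum hs0 hs1]
    rw [← Complex.re_sum, h2, Complex.ofReal_re]

end DivCurl

/-! ### Quadratic sources and their bound -/

section QuadraticSources

/-- The quadratic source of the divergence. -/
def minorSum (u w : E3 → E3) (a : E3) : ℝ :=
  ∑ j : Fin 3, ∑ i ∈ Finset.Iio j, (jac u a j i * jac w a i j - jac u a i i * jac w a j j)

/-- The cubic source of the divergence. -/
def detMix (u w z : E3 → E3) (a : E3) : ℝ :=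
  Matrix.det (Matrix.of fun i : Fin 3 => ![jac u a i 0, jac w a i 1, jac z a i 2])

lemma minorSum_eq (u w : E3 → E3) (a : E3) :
    minorSum u w a = (jac u a 1 0 * jac w a 0 1 - jac u a 0 0 * jac w a 1 1)
      + (jac u a 2 0 * jac w a 0 2 - jac u a 0 0 * jac w a 2 2)
      + (jac u a 2 1 * jac w a 1 2 - jac u a 1 1 * jac w a 2 2) := by
  have h0 : (Finset.Iio 0 : Finset (Fin 3)) = ∅ := by decide
  have h1 : (Finset.Iio 1 : Finset (Fin 3)) = {0} := by decide
  have h2 : (Finset.Iio 2 : Finset (Fin 3)) = {0, 1} := by decide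
  rw [minorSum, Fin.sum_univ_three, h0, h1, h2, Finset.sum_empty, Finset.sum_singleton,
    Finset.sum_pair (by decide)]
  ring

lemma detMix_eq (u w z : E3 → E3) (a : E3) :
    detMix u w z a = jac u a 0 0 * (jac w a 1 1 * jac z a 2 2) - jac u a 0 0 * (jac w a 2 1 * jac z a 1 2)
      - jac u a 1 0 * (jac w a 0 1 * jac z a 2 2) + jac u a 1 0 * (jac w a 2 1 * jac z a 0 2)
      + jac u a 2 0 * (jac w a 0 1 * jac z a 1 2) - jac u a 2 0 * (jac w a 1 1 * jac z a 0 2) := by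
  rw [detMix, Matrix.det_fin_three]
  simp
  ring

/-- The term of frequency `p` in the Fourier series of the derivative `∂ₖ uⱼ`. -/
def jacTerm (c : Wave → C3) (a : E3) (k j : Fin 3) (p : Wave) : ℂ :=
  Complex.I * (p k : ℂ) * c p j * planeWave p a

lemma norm_jacTerm_le (c : Wave → C3) (a : E3) (k j : Fin 3) (p : Wave) :
    ‖jacTerm c a k j p‖ ≤ p.length * ‖c p‖ := by
  rw [jacTerm, norm_mul, norm_planeWave, mul_one, norm_mul, norm_mul, Complex.norm_I, one_mul]
  refine mul_le_mul ?_ (norm_apply_le _ _) (norm_nonneg _) p.length_nonneg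
  rw [← Wave.norm_vec, ← Wave.vec_apply]
  exact norm_apply_le p.vec k

lemma summable_norm_jacTerm {c : Wave → C3} (h1 : Summable fun p => p.length * ‖c p‖) (a : E3)
    (k j : Fin 3) : Summable fun p => ‖jacTerm c a k j p‖ :=
  Summable.of_nonneg_of_le (fun _ => norm_nonneg _) (norm_jacTerm_le c a k j) h1

section Products

variable {u w z : E3 → E3} {c d e : Wave → C3}

lemma hasSum_jacTerm (hu : HasAbsFourierSeries u c)
    (hu1 : Summable fun p => p.length * ‖c p‖) (a : E3) (k j : Fin 3) :
    HasSum (jacTerm c a k j) (jac u a k j : ℂ) :=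
  hu.hasSum_jac hu1 a k j

lemma hasSum_prod_mul {ι κ : Type*} {f : ι → ℂ} {g : κ → ℂ} {x y : ℂ} (hf : HasSum f x)
    (hg : HasSum g y) (hfs : Summable fun i => ‖f i‖) (hgs : Summable fun i => ‖g i‖) :
    HasSum (fun i : ι × κ => f i.1 * g i.2) (x * y) :=
  hf.mul hg (summable_mul_of_summable_norm hfs hgs)

lemma hasSum_mul_mul {ι : Type*} {f g h : ι → ℂ} {x y z : ℂ} (hf : HasSum f x)
    (hg : HasSum g y) (hh : HasSum h z) (hfs : Summable fun i => ‖f i‖)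
    (hgs : Summable fun i => ‖g i‖) (hhs : Summable fun i => ‖h i‖) :
    HasSum (fun i : ι × ι × ι => f i.1 * (g i.2.1 * h i.2.2)) (x * (y * z)) := by
  have h1 := hasSum_prod_mul hg hh hgs hhs
  have h2 := Summable.mul_norm (f := g) (g := h) hgs hhs
  exact hasSum_prod_mul (f := f) (g := fun i : ι × ι => g i.1 * h i.2) hf h1 hfs h2

lemma hasSum_jac_mul (hu : HasAbsFourierSeries u c) (hu1 : Summable fun p => p.length * ‖c p‖)
    (hw : HasAbsFourierSeries w d) (hw1 : Summable fun p => p.length * ‖d p‖) (a : E3)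
    (k j l m : Fin 3) :
    HasSum (fun x : Wave × Wave => jacTerm c a k j x.1 * jacTerm d a l m x.2)
      ((jac u a k j : ℂ) * jac w a l m) :=
  hasSum_prod_mul (hasSum_jacTerm hu hu1 a k j) (hasSum_jacTerm hw hw1 a l m)
    (summable_norm_jacTerm hu1 a k j) (summable_norm_jacTerm hw1 a l m)

lemma hasSum_jac_mul_mul (hu : HasAbsFourierSeries u c)
    (hu1 : Summable fun p => p.length * ‖c p‖) (hw : HasAbsFourierSeries w d)
    (hw1 : Summable fun p => p.length * ‖d p‖) (hz : HasAbsFourierSeries z e)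
    (hz1 : Summable fun p => p.length * ‖e p‖) (a : E3) (k j l m r n : Fin 3) :
    HasSum (fun x : Wave × Wave × Wave =>
        jacTerm c a k j x.1 * (jacTerm d a l m x.2.1 * jacTerm e a r n x.2.2))
      ((jac u a k j : ℂ) * (jac w a l m * jac z a r n)) :=
  hasSum_mul_mul (hasSum_jacTerm hu hu1 a k j) (hasSum_jacTerm hw hw1 a l m)
    (hasSum_jacTerm hz hz1 a r n) (summable_norm_jacTerm hu1 a k j)
    (summable_norm_jacTerm hw1 a l m) (summable_norm_jacTerm hz1 a r n)

lemma tsum_mul_le {ι κ : Type*} {f : ι → ℝ} {g : κ → ℝ} {A B : ℝ} (hf : Summable f)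
    (hg : Summable g)
    (hf0 : ∀ p, 0 ≤ f p) (hg0 : ∀ p, 0 ≤ g p) (hA : ∑' p, f p ≤ A) (hB : ∑' p, g p ≤ B) :
    Summable (fun x : ι × κ => f x.1 * g x.2) ∧
      ∑' x : ι × κ, f x.1 * g x.2 ≤ A * B := by
  have hs := hf.mul_of_nonneg hg hf0 hg0
  refine ⟨hs, ?_⟩
  rw [← hf.tsum_mul_tsum hg hs]
  exact mul_le_mul hA hB (tsum_nonneg hg0) ((tsum_nonneg hf0).trans hA)

lemma gradCross_apply (u w : E3 → E3) (a : E3) :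
    gradCross u w a = !₂[∑ k, (jac u a 1 k * jac w a 2 k - jac u a 2 k * jac w a 1 k),
      ∑ k, (jac u a 2 k * jac w a 0 k - jac u a 0 k * jac w a 2 k),
      ∑ k, (jac u a 0 k * jac w a 1 k - jac u a 1 k * jac w a 0 k)] := by
  ext l
  fin_cases l <;> simp [gradCross, Fin.sum_univ_three, cross_apply, gradComp] <;> ring

/-- The div-curl system with symmetrised quadratic sources. -/
lemma exists_good_quadratic {A B θ κ : ℝ} (hu : Good u A) (hw : Good w B) (hκ : 0 ≤ κ)
    (hθ : θ ^ 2 + 1 / 4 ≤ κ ^ 2) :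
    ∃ f, Good f (κ * (A * B)) ∧ (∀ a, curl f a = θ • gradCross u w a) ∧
      ∀ a, divergence f a = 1 / 2 * (minorSum u w a + minorSum w u a) := by
  obtain ⟨c, hc, hc0, hc1, hcA⟩ := hu
  obtain ⟨d, hd, hd0, hd1, hdB⟩ := hw
  have H := fun a k j l m => hasSum_jac_mul hc hc1 hd hd1 a k j l m
  obtain ⟨hbs, hbt⟩ := tsum_mul_le hc1 hd1 (fun p => mul_nonneg p.length_nonneg (norm_nonneg _))
    (fun p => mul_nonneg p.length_nonneg (norm_nonneg _)) hcA hdB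
  let P : Wave × Wave → Wave := fun x => x.1 + x.2
  -- Each gradient contributes a factor `i`: the sum of `(ip c_k) × (iq d_k)` over `k` is `-(c · d)
  -- p × q`.
  let γ : Wave × Wave → C3 := fun x =>
    (-(θ : ℂ) * cdot (c x.1) (d x.2)) • ccross x.1.vec x.2.vec
  -- Symmetrisation in the two fields combines the 2 × 2 minors into `(p × q) · (c × d)`.
  let δ : Wave × Wave → ℂ := fun x =>
    1 / 2 * cdot (ccross x.1.vec x.2.vec) (ccross (c x.1) (d x.2))
  let b : Wave × Wave → ℝ := fun x => κ * ((x.1.length * ‖c x.1‖) * (x.2.length * ‖d x.2‖))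
  have hnn : ∀ x : Wave × Wave, 0 ≤ (x.1.length * ‖c x.1‖) * (x.2.length * ‖d x.2‖) := fun x =>
    mul_nonneg (mul_nonneg x.1.length_nonneg (norm_nonneg _))
      (mul_nonneg x.2.length_nonneg (norm_nonneg _))
  -- With `S = |p||c||q||d|`, the two moduli are at most `|θ| S` and `S/2`.
  have hle : ∀ x, ‖γ x‖ ^ 2 + ‖δ x‖ ^ 2 ≤ b x ^ 2 := by
    intro x
    have h1 := norm_ccross_le x.1.vec x.2.vec
    rw [Wave.norm_vec, Wave.norm_vec] at h1
    have hR := mul_nonneg x.1.length_nonneg x.2.length_nonneg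
    have hS := mul_nonneg (norm_nonneg (c x.1)) (norm_nonneg (d x.2))
    have h2 : ‖cdot (c x.1) (d x.2)‖ * ‖ccross x.1.vec x.2.vec‖
        ≤ (‖c x.1‖ * ‖d x.2‖) * (x.1.length * x.2.length) :=
      mul_le_mul (norm_cdot_le _ _) h1 (norm_nonneg _) hS
    have h3 : ‖cdot (ccross x.1.vec x.2.vec) (ccross (c x.1) (d x.2))‖
        ≤ (x.1.length * x.2.length) * (‖c x.1‖ * ‖d x.2‖) :=
      (norm_cdot_le _ _).trans (mul_le_mul h1 (norm_ccross_le _ _) (norm_nonneg _) hR)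
    have e1 : ‖γ x‖ = |θ| * (‖cdot (c x.1) (d x.2)‖ * ‖ccross x.1.vec x.2.vec‖) := by
      simp only [γ, norm_smul, norm_mul, norm_neg, Complex.norm_real, Real.norm_eq_abs]
      ring
    have e2 : ‖δ x‖ = 1 / 2 * ‖cdot (ccross x.1.vec x.2.vec) (ccross (c x.1) (d x.2))‖ := by
      simp [δ]
    set S := (x.1.length * ‖c x.1‖) * (x.2.length * ‖d x.2‖) with hSdef
    have h2' : ‖cdot (c x.1) (d x.2)‖ * ‖ccross x.1.vec x.2.vec‖ ≤ S := h2.trans (le_of_eq (by ring))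
    have h3' : ‖cdot (ccross x.1.vec x.2.vec) (ccross (c x.1) (d x.2))‖ ≤ S :=
      h3.trans (le_of_eq (by ring))
    have h4 := pow_le_pow_left₀ (by positivity) h2' 2
    have h5 := pow_le_pow_left₀ (by positivity) h3' 2
    rw [e1, e2, mul_pow, mul_pow (1 / 2 : ℝ), sq_abs]
    calc _ ≤ θ ^ 2 * S ^ 2 + (1 / 2) ^ 2 * S ^ 2 :=
          add_le_add (mul_le_mul_of_nonneg_left h4 (by positivity))
            (mul_le_mul_of_nonneg_left h5 (by positivity))
      _ = (θ ^ 2 + 1 / 4) * S ^ 2 := by ring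
      _ ≤ κ ^ 2 * S ^ 2 := by gcongr
      _ = b x ^ 2 := by simp only [b, ← hSdef]; ring
  -- Transversality: `p × q` is orthogonal to `p + q`.
  have hγ : ∀ x, cdot (P x).vec (γ x) = 0 := by
    intro x
    simp [γ, P, cdot, ccross, Fin.sum_univ_three]
    ring
  -- Opposite wave vectors are parallel, so both sources have zero mean, as solvability requires.
  have hz : ∀ x, P x = 0 → γ x = 0 ∧ δ x = 0 := by
    intro x hx
    have hx2 : x.2 = -x.1 := (neg_eq_of_add_eq_zero_right hx).symm
    have : ccross x.1.vec x.2.vec = 0 := by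
      rw [hx2]
      ext j
      fin_cases j <;> simp [ccross] <;> ring
    simp [γ, δ, this, cdot]
  have hC : ∀ a l, HasSum (fun x => γ x l * planeWave (P x) a) (((θ • gradCross u w a) l : ℝ) : ℂ) := by
    intro a l
    have h := fun k j => (hasSum_sum (s := Finset.univ) fun r (_ : r ∈ Finset.univ) =>
      (H a k r j r).sub (H a j r k r)).mul_left (θ : ℂ)
    fin_cases l
    · have hv : ((θ • gradCross u w a) 0 : ℂ) = θ * ∑ r, ((jac u a 1 r : ℂ) * jac w a 2 r
          - jac u a 2 r * jac w a 1 r) := by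
        simp [gradCross_apply]
      change HasSum _ (((θ • gradCross u w a) 0 : ℝ) : ℂ)
      rw [hv]
      refine (h 1 2).congr_fun fun x => ?_
      simp [γ, P, cdot, ccross, jacTerm, planeWave_add, Fin.sum_univ_three]
      linear_combination (-(θ : ℂ) * (c x.1 0 * d x.2 0 + c x.1 1 * d x.2 1 + c x.1 2 * d x.2 2)
        * (x.1 1 * x.2 2 - x.1 2 * x.2 1)
        * planeWave x.1 a * planeWave x.2 a) * Complex.I_mul_I
    · have hv : ((θ • gradCross u w a) 1 : ℂ) = θ * ∑ r, ((jac u a 2 r : ℂ) * jac w a 0 r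
          - jac u a 0 r * jac w a 2 r) := by
        simp [gradCross_apply]
      change HasSum _ (((θ • gradCross u w a) 1 : ℝ) : ℂ)
      rw [hv]
      refine (h 2 0).congr_fun fun x => ?_
      simp [γ, P, cdot, ccross, jacTerm, planeWave_add, Fin.sum_univ_three]
      linear_combination (-(θ : ℂ) * (c x.1 0 * d x.2 0 + c x.1 1 * d x.2 1 + c x.1 2 * d x.2 2)
        * (x.1 2 * x.2 0 - x.1 0 * x.2 2)
        * planeWave x.1 a * planeWave x.2 a) * Complex.I_mul_I
    · have hv : ((θ • gradCross u w a) 2 : ℂ) = θ * ∑ r, ((jac u a 0 r : ℂ) * jac w a 1 r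
          - jac u a 1 r * jac w a 0 r) := by
        simp [gradCross_apply]
      change HasSum _ (((θ • gradCross u w a) 2 : ℝ) : ℂ)
      rw [hv]
      refine (h 0 1).congr_fun fun x => ?_
      simp [γ, P, cdot, ccross, jacTerm, planeWave_add, Fin.sum_univ_three]
      linear_combination (-(θ : ℂ) * (c x.1 0 * d x.2 0 + c x.1 1 * d x.2 1 + c x.1 2 * d x.2 2)
        * (x.1 0 * x.2 1 - x.1 1 * x.2 0)
        * planeWave x.1 a * planeWave x.2 a) * Complex.I_mul_I
  have hD : ∀ a, HasSum (fun x => δ x * planeWave (P x) a)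
      ((1 / 2 * (minorSum u w a + minorSum w u a) : ℝ) : ℂ) := by
    intro a
    have h := fun i j => ((H a j i i j).sub (H a i i j j)).add ((H a i j j i).sub (H a j j i i))
    have h2 := (((h 0 1).add (h 0 2)).add (h 1 2)).mul_left (1 / 2)
    have hv : ((1 / 2 * (minorSum u w a + minorSum w u a) : ℝ) : ℂ) = 1 / 2 *
        ((((jac u a 1 0 : ℂ) * jac w a 0 1 - jac u a 0 0 * jac w a 1 1)
            + (jac u a 0 1 * jac w a 1 0 - jac u a 1 1 * jac w a 0 0))
          + ((jac u a 2 0 * jac w a 0 2 - jac u a 0 0 * jac w a 2 2)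
            + (jac u a 0 2 * jac w a 2 0 - jac u a 2 2 * jac w a 0 0))
          + ((jac u a 2 1 * jac w a 1 2 - jac u a 1 1 * jac w a 2 2)
            + (jac u a 1 2 * jac w a 2 1 - jac u a 2 2 * jac w a 1 1))) := by
      rw [minorSum_eq, minorSum_eq]
      push_cast
      ring
    rw [hv]
    refine h2.congr_fun fun x => ?_
    simp [δ, P, cdot, ccross, jacTerm, planeWave_add, Fin.sum_univ_three]
    linear_combination (1 / 2 * ((x.1 1 * x.2 2 - x.1 2 * x.2 1) * (c x.1 1 * d x.2 2 - c x.1 2 * d x.2 1)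
      + (x.1 2 * x.2 0 - x.1 0 * x.2 2) * (c x.1 2 * d x.2 0 - c x.1 0 * d x.2 2)
      + (x.1 0 * x.2 1 - x.1 1 * x.2 0) * (c x.1 0 * d x.2 1 - c x.1 1 * d x.2 0))
        * planeWave x.1 a * planeWave x.2 a) * Complex.I_mul_I
  obtain ⟨f, ⟨g, hg, hg0, hg1, hgA⟩, hcurl, hdiv⟩ := exists_good_curl_div hγ hz
    (fun x => mul_nonneg hκ (hnn x)) (hbs.mul_left κ) hle hC hD
  refine ⟨f, ⟨g, hg, hg0, hg1, hgA.trans ?_⟩, hcurl, hdiv⟩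
  rw [tsum_mul_left]
  exact mul_le_mul_of_nonneg_left hbt hκ

end Products

end QuadraticSources

/-! ### The cubic source and its bound -/

section CubicSources

variable {u w z : E3 → E3} {c d e : Wave → C3}

/-- The determinant with columns `∇u_j`, `∇w_m`, `∇z_n`. -/
def gradDet (u w z : E3 → E3) (a : E3) (j m n : Fin 3) : ℝ :=
  jac u a 0 j * (jac w a 1 m * jac z a 2 n) - jac u a 0 j * (jac w a 2 m * jac z a 1 n)
    - jac u a 1 j * (jac w a 0 m * jac z a 2 n) + jac u a 1 j * (jac w a 2 m * jac z a 0 n)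
    + jac u a 2 j * (jac w a 0 m * jac z a 1 n) - jac u a 2 j * (jac w a 1 m * jac z a 0 n)

/-- A determinant of three gradients yields `i³ = -i` times the determinant of the wave vectors. -/
lemma hasSum_gradDet (hu : HasAbsFourierSeries u c)
    (hu1 : Summable fun p => p.length * ‖c p‖) (hw : HasAbsFourierSeries w d)
    (hw1 : Summable fun p => p.length * ‖d p‖) (hz : HasAbsFourierSeries z e)
    (hz1 : Summable fun p => p.length * ‖e p‖) (a : E3) (j m n : Fin 3) :
    HasSum (fun x : Wave × Wave × Wave =>
        -Complex.I * cdot (ccross x.1.vec x.2.1.vec) x.2.2.vec * (c x.1 j * d x.2.1 m * e x.2.2 n)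
          * planeWave (x.1 + x.2.1 + x.2.2) a)
      (gradDet u w z a j m n : ℂ) := by
  have H := fun k l r => hasSum_jac_mul_mul hu hu1 hw hw1 hz hz1 a k j l m r n
  have h := (((((H 0 1 2).sub (H 0 2 1)).sub (H 1 0 2)).add (H 1 2 0)).add (H 2 0 1)).sub (H 2 1 0)
  have hv : (gradDet u w z a j m n : ℂ) = jac u a 0 j * (jac w a 1 m * jac z a 2 n)
      - jac u a 0 j * (jac w a 2 m * jac z a 1 n) - jac u a 1 j * (jac w a 0 m * jac z a 2 n)
      + jac u a 1 j * (jac w a 2 m * jac z a 0 n) + jac u a 2 j * (jac w a 0 m * jac z a 1 n)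
      - jac u a 2 j * (jac w a 1 m * jac z a 0 n) := by
    rw [gradDet]
    push_cast
    ring
  rw [hv]
  refine h.congr_fun fun x => ?_
  have hI : Complex.I * Complex.I * Complex.I = -Complex.I := by rw [Complex.I_mul_I]; ring
  simp only [jacTerm, planeWave_add, cdot, ccross, Fin.sum_univ_three, Wave.vec_apply]
  simp
  linear_combination (-(((x.1 1 * x.2.1 2 - x.1 2 * x.2.1 1) * x.2.2 0
    + (x.1 2 * x.2.1 0 - x.1 0 * x.2.1 2) * x.2.2 1
    + (x.1 0 * x.2.1 1 - x.1 1 * x.2.1 0) * x.2.2 2) * (c x.1 j * d x.2.1 m * e x.2.2 n)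
      * (planeWave x.1 a * planeWave x.2.1 a * planeWave x.2.2 a))) * hI

/-- Permuting the fields amounts to permuting the components with signs. On the Fourier side the
right-hand side therefore gives a second determinant, that of the three coefficients. -/
lemma sum_detMix_eq (u w z : E3 → E3) (a : E3) :
    detMix u w z a + detMix w z u a + detMix z u w a + detMix w u z a + detMix u z w a
      + detMix z w u a
    = gradDet u w z a 0 1 2 - gradDet u w z a 0 2 1 - gradDet u w z a 1 0 2
      + gradDet u w z a 1 2 0 + gradDet u w z a 2 0 1 - gradDet u w z a 2 1 0 := by
  simp only [detMix_eq, gradDet]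
  ring

/-- The div-curl system with symmetrised cubic source. -/
lemma exists_good_cubic {A B K : ℝ} (hu : Good u A) (hw : Good w B) (hz : Good z K) :
    ∃ f, Good f (1 / 6 * (A * (B * K))) ∧ (∀ a, curl f a = 0) ∧
      ∀ a, divergence f a = -(1 / 6) * (detMix u w z a + detMix w z u a + detMix z u w a
        + detMix w u z a + detMix u z w a + detMix z w u a) := by
  obtain ⟨c, hc, hc0, hc1, hcA⟩ := hu
  obtain ⟨d, hd, hd0, hd1, hdB⟩ := hw
  obtain ⟨e, he, he0, he1, heK⟩ := hz
  have nnc : ∀ p : Wave, 0 ≤ p.length * ‖c p‖ := fun p => mul_nonneg p.length_nonneg (norm_nonneg _)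
  have nnd : ∀ p : Wave, 0 ≤ p.length * ‖d p‖ := fun p => mul_nonneg p.length_nonneg (norm_nonneg _)
  have nne : ∀ p : Wave, 0 ≤ p.length * ‖e p‖ := fun p => mul_nonneg p.length_nonneg (norm_nonneg _)
  obtain ⟨hs2, ht2⟩ := tsum_mul_le hd1 he1 nnd nne hdB heK
  obtain ⟨hbs, hbt⟩ := tsum_mul_le hc1 hs2 nnc (fun x => mul_nonneg (nnd _) (nne _)) hcA ht2
  let P : Wave × Wave × Wave → Wave := fun x => x.1 + x.2.1 + x.2.2
  -- Both determinants are bounded by products of lengths, so the factor 1/6 survives the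
  -- symmetrisation; a term by term bound would lose it.
  let δ : Wave × Wave × Wave → ℂ := fun x => 1 / 6 * Complex.I *
    (cdot (ccross x.1.vec x.2.1.vec) x.2.2.vec * cdot (ccross (c x.1) (d x.2.1)) (e x.2.2))
  let b : Wave × Wave × Wave → ℝ := fun x => 1 / 6 * ((x.1.length * ‖c x.1‖) *
    ((x.2.1.length * ‖d x.2.1‖) * (x.2.2.length * ‖e x.2.2‖)))
  have hb : ∀ x, 0 ≤ b x := fun x =>
    mul_nonneg (by norm_num) (mul_nonneg (nnc _) (mul_nonneg (nnd _) (nne _)))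
  have htriple : ∀ x y t : C3, ‖cdot (ccross x y) t‖ ≤ ‖x‖ * ‖y‖ * ‖t‖ := fun x y t =>
    (norm_cdot_le _ _).trans (mul_le_mul_of_nonneg_right (norm_ccross_le _ _) (norm_nonneg _))
  have hle : ∀ x, ‖(0 : C3)‖ ^ 2 + ‖δ x‖ ^ 2 ≤ b x ^ 2 := by
    intro x
    rw [norm_zero, zero_pow two_ne_zero, zero_add]
    refine pow_le_pow_left₀ (norm_nonneg _) ?_ 2
    have h1 := htriple x.1.vec x.2.1.vec x.2.2.vec
    rw [Wave.norm_vec, Wave.norm_vec, Wave.norm_vec] at h1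
    have h2 := htriple (c x.1) (d x.2.1) (e x.2.2)
    have h3 := mul_le_mul h1 h2 (norm_nonneg _) (by
      have := x.1.length_nonneg
      have := x.2.1.length_nonneg
      have := x.2.2.length_nonneg
      positivity)
    have e1 : ‖δ x‖ = 1 / 6 * (‖cdot (ccross x.1.vec x.2.1.vec) x.2.2.vec‖ *
        ‖cdot (ccross (c x.1) (d x.2.1)) (e x.2.2)‖) := by simp [δ]
    rw [e1]
    calc _ ≤ 1 / 6 * (x.1.length * x.2.1.length * x.2.2.length *
          (‖c x.1‖ * ‖d x.2.1‖ * ‖e x.2.2‖)) := mul_le_mul_of_nonneg_left h3 (by norm_num)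
      _ = b x := by simp only [b]; ring
  -- Three wave vectors of zero sum are linearly dependent.
  have hz' : ∀ x, P x = 0 → (0 : C3) = 0 ∧ δ x = 0 := by
    intro x hx
    have hx2 : x.2.2 = -(x.1 + x.2.1) := (neg_eq_of_add_eq_zero_right hx).symm
    have : cdot (ccross x.1.vec x.2.1.vec) x.2.2.vec = 0 := by
      rw [hx2]
      simp [cdot, ccross, Fin.sum_univ_three]
      ring
    simp [δ, this]
  have hD : ∀ a, HasSum (fun x => δ x * planeWave (P x) a)
      ((-(1 / 6) * (detMix u w z a + detMix w z u a + detMix z u w a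
        + detMix w u z a + detMix u z w a + detMix z w u a) : ℝ) : ℂ) := by
    intro a
    have H := fun j m n => hasSum_gradDet hc hc1 hd hd1 he he1 a j m n
    have h := ((((((H 0 1 2).sub (H 0 2 1)).sub (H 1 0 2)).add (H 1 2 0)).add (H 2 0 1)).sub
      (H 2 1 0)).mul_left (-(1 / 6))
    rw [sum_detMix_eq]
    push_cast
    refine h.congr_fun fun x => ?_
    simp only [δ, P]
    have : cdot (ccross (c x.1) (d x.2.1)) (e x.2.2)
        = (c x.1 1 * d x.2.1 2 - c x.1 2 * d x.2.1 1) * e x.2.2 0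
        + (c x.1 2 * d x.2.1 0 - c x.1 0 * d x.2.1 2) * e x.2.2 1
        + (c x.1 0 * d x.2.1 1 - c x.1 1 * d x.2.1 0) * e x.2.2 2 := by
      simp [cdot, ccross, Fin.sum_univ_three]
    rw [this]
    ring
  obtain ⟨f, ⟨g, hg, hg0, hg1, hgA⟩, hcurl, hdiv⟩ := exists_good_curl_div (P := P)
    (γ := fun _ => 0) (C := fun _ => 0) (fun x => by simp [cdot]) hz' hb (hbs.mul_left (1 / 6)) hle
    (fun a l => by simp) hD
  refine ⟨f, ⟨g, hg, hg0, hg1, hgA.trans ?_⟩, hcurl, hdiv⟩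
  rw [tsum_mul_left]
  exact mul_le_mul_of_nonneg_left hbt (by norm_num)

end CubicSources

/-! ### The recurrence: symmetrisation, existence with bounds, uniqueness -/

section Recursion

lemma good_zero : Good 0 0 :=
  ⟨0, ⟨by simp, fun a j => by simp⟩, rfl, by simp, by simp⟩

lemma Good.add {u w : E3 → E3} {A B : ℝ} (hu : Good u A) (hw : Good w B) :
    Good (u + w) (A + B) := by
  obtain ⟨c, hc, hc0, hc1, hcA⟩ := hu
  obtain ⟨d, hd, hd0, hd1, hdB⟩ := hw
  have hle : ∀ p : Wave, p.length * ‖c p + d p‖ ≤ p.length * ‖c p‖ + p.length * ‖d p‖ := fun p => by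
    rw [← mul_add]
    exact mul_le_mul_of_nonneg_left (norm_add_le _ _) p.length_nonneg
  have hs : Summable fun p => p.length * ‖c p + d p‖ :=
    Summable.of_nonneg_of_le (fun p => mul_nonneg p.length_nonneg (norm_nonneg _)) hle (hc1.add hd1)
  refine ⟨fun p => c p + d p, ⟨?_, fun a j => ?_⟩, by simp [hc0, hd0], hs, ?_⟩
  · exact Summable.of_nonneg_of_le (fun p => norm_nonneg _) (fun p => norm_add_le _ _)
      (hc.1.add hd.1)
  · have h := (hc.2 a j).add (hd.2 a j)
    have hv : (((u + w) a j : ℝ) : ℂ) = (u a j : ℂ) + (w a j : ℂ) := by simp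
    rw [hv]
    refine h.congr_fun fun p => ?_
    rw [PiLp.add_apply, add_mul]
  · refine (hs.tsum_le_tsum hle (hc1.add hd1)).trans ?_
    rw [hc1.tsum_add hd1]
    exact add_le_add hcA hdB

lemma jac_add {u w : E3 → E3} (hu : ContDiff ℝ 1 u) (hw : ContDiff ℝ 1 w) (a : E3) :
    jac (u + w) a = jac u a + jac w a := by
  ext i j
  simp only [jac, Matrix.of_apply, Matrix.add_apply]
  rw [fderiv_add (hu.differentiable one_ne_zero a) (hw.differentiable one_ne_zero a)]
  simp

lemma curl_add {u w : E3 → E3} (hu : ContDiff ℝ 1 u) (hw : ContDiff ℝ 1 w) (a : E3) :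
    curl (u + w) a = curl u a + curl w a := by
  ext j
  fin_cases j <;> simp [curl, jac_add hu hw] <;> ring

lemma divergence_add {u w : E3 → E3} (hu : ContDiff ℝ 1 u) (hw : ContDiff ℝ 1 w) (a : E3) :
    divergence (u + w) a = divergence u a + divergence w a := by
  simp [divergence, jac_add hu hw, Finset.sum_add_distrib]

lemma jac_zero (a : E3) : jac 0 a = 0 := by
  ext i j
  simp [jac]

lemma curl_zero (a : E3) : curl 0 a = 0 := by
  ext j
  fin_cases j <;> simp [curl, jac_zero]

lemma divergence_zero (a : E3) : divergence 0 a = 0 := by simp [divergence, jac_zero]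

lemma good_sum {ι : Type*} (s : Finset ι) {f : ι → E3 → E3} {A : ι → ℝ}
    (h : ∀ i ∈ s, Good (f i) (A i)) :
    Good (∑ i ∈ s, f i) (∑ i ∈ s, A i) ∧
      (∀ a, curl (∑ i ∈ s, f i) a = ∑ i ∈ s, curl (f i) a) ∧
      ∀ a, divergence (∑ i ∈ s, f i) a = ∑ i ∈ s, divergence (f i) a := by
  classical
  induction s using Finset.induction_on with
  | empty => simpa using ⟨good_zero, curl_zero, divergence_zero⟩
  | insert i s hi ih =>
    obtain ⟨h1, h2, h3⟩ := ih fun j hj => h j (Finset.mem_insert_of_mem hj)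
    have h0 := h i (Finset.mem_insert_self i s)
    have c0 := h0.isPeriodicField.contDiff
    have c1 := h1.isPeriodicField.contDiff
    rw [Finset.sum_insert hi, Finset.sum_insert hi]
    refine ⟨h0.add h1, fun a => ?_, fun a => ?_⟩
    · rw [curl_add c0 c1, h2, Finset.sum_insert hi]
    · rw [divergence_add c0 c1, h3, Finset.sum_insert hi]

section Sums

variable {M : Type*} [AddCommMonoid M]

lemma sum_Ioo_reflect (s : ℕ) (h : ℕ → M) :
    ∑ m ∈ Finset.Ioo 0 s, h m = ∑ m ∈ Finset.Ioo 0 s, h (s - m) := by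
  refine Finset.sum_nbij' (fun m => s - m) (fun m => s - m) ?_ ?_ ?_ ?_ ?_ <;> intro m hm <;>
    simp only [Finset.mem_Ioo] at hm ⊢
  · omega
  · omega
  · omega
  · omega
  · congr 1; omega

/-- The sum over `l + m + n = s` with `l, m, n ≥ 1`. -/
def tripleSum (s : ℕ) (D : ℕ → ℕ → ℕ → M) : M :=
  ∑ l ∈ Finset.Ioo 0 s, ∑ m ∈ Finset.Ioo 0 (s - l), D l m (s - l - m)

lemma tripleSum_swap₁₂ (s : ℕ) (D : ℕ → ℕ → ℕ → M) :
    tripleSum s D = tripleSum s fun l m n => D m l n := by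
  unfold tripleSum
  rw [Finset.sum_comm' (t' := Finset.Ioo 0 s) (s' := fun m => Finset.Ioo 0 (s - m))]
  · refine Finset.sum_congr rfl fun l _ => Finset.sum_congr rfl fun m _ => ?_
    rw [Nat.sub_right_comm]
  · intro l m
    simp only [Finset.mem_Ioo]
    omega

lemma tripleSum_swap₂₃ (s : ℕ) (D : ℕ → ℕ → ℕ → M) :
    tripleSum s D = tripleSum s fun l m n => D l n m := by
  unfold tripleSum
  refine Finset.sum_congr rfl fun l _ => ?_
  rw [sum_Ioo_reflect]
  refine Finset.sum_congr rfl fun m hm => ?_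
  simp only [Finset.mem_Ioo] at hm
  rw [Nat.sub_sub_self hm.2.le]

end Sums

/-- The index set is invariant under two adjacent transpositions, which generate all six
permutations. -/
lemma tripleSum_symm (s : ℕ) (D : ℕ → ℕ → ℕ → ℝ) :
    tripleSum s (fun l m n => D l m n + D m n l + D n l m + D m l n + D l n m + D n m l)
      = 6 * tripleSum s D := by
  have h1 := tripleSum_swap₁₂ s D
  have h2 := tripleSum_swap₂₃ s D
  have h3 := tripleSum_swap₁₂ s fun l m n => D l n m
  have h4 := tripleSum_swap₂₃ s fun l m n => D m l n
  have h5 := tripleSum_swap₁₂ s fun l m n => D n l m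
  have hadd : ∀ E F : ℕ → ℕ → ℕ → ℝ, tripleSum s (fun l m n => E l m n + F l m n)
      = tripleSum s E + tripleSum s F := fun E F => by
    simp [tripleSum, Finset.sum_add_distrib]
  rw [hadd, hadd, hadd, hadd, hadd]
  linarith

lemma gradCross_swap (u w : E3 → E3) (a : E3) : gradCross w u a = -gradCross u w a := by
  rw [gradCross_apply, gradCross_apply]
  ext l
  fin_cases l <;> simp [Fin.sum_univ_three] <;> ring

/-- Recursive sequences given by a relation that involves the preceding terms only. -/
lemma exists_strong_rec {α : Type*} (R : ℕ → (ℕ → α) → α → Prop) [Nonempty α]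
    (hloc : ∀ n f g x, (∀ m < n, f m = g m) → R n f x → R n g x)
    (hex : ∀ n f, (∀ m < n, R m f (f m)) → ∃ x, R n f x) : ∃ f : ℕ → α, ∀ n, R n f (f n) := by
  classical
  -- Terms of index at least `n` are filled with a default value; `hloc` makes the filling
  -- irrelevant.
  let step : ∀ n, (∀ m < n, α) → α := fun n prev =>
    Classical.epsilon (R n fun m => if h : m < n then prev m h else Classical.arbitrary α)
  let f : ℕ → α := fun n => (wellFounded_lt (α := ℕ)).fix step n
  have hf : ∀ n, f n = Classical.epsilon
      (R n fun m => if m < n then f m else Classical.arbitrary α) := by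
    intro n
    change (wellFounded_lt (α := ℕ)).fix step n = _
    rw [WellFounded.fix_eq]
    simp only [step, f, dite_eq_ite]
  refine ⟨f, fun n => ?_⟩
  induction n using Nat.strong_induction_on with
  | _ n ih =>
    obtain ⟨x, hx⟩ := hex n f ih
    have hx' := hloc n f (fun m => if m < n then f m else Classical.arbitrary α) x
      (fun m hm => by simp [hm]) hx
    have := Classical.epsilon_spec (p := R n fun m => if m < n then f m else Classical.arbitrary α)
      ⟨x, hx'⟩
    rw [← hf n] at this
    exact hloc n _ f (f n) (fun m hm => by simp [hm]) this

/-- The constant in the bound of the quadratic terms of order `s`. -/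
def quadConst (s : ℕ) : ℝ := if s = 2 then 1 / 2 else 1 / Real.sqrt 2

/-- The recursion for the majorants of the gradients of the Taylor coefficients. -/
def IsMajorant (Γ : ℝ) (A : ℕ → ℝ) : Prop :=
  ∀ s, A s = (if s = 1 then Γ else 0) + ∑ m ∈ Finset.Ioo 0 s, quadConst s * (A m * A (s - m))
    + tripleSum s fun l m n => 1 / 6 * (A l * (A m * A n))

lemma tripleSum_congr {M α : Type*} [AddCommMonoid M] (s : ℕ) {f g : ℕ → α}
    (h : ∀ m < s, f m = g m) (D : α → α → α → M) :
    tripleSum s (fun l m n => D (f l) (f m) (f n)) = tripleSum s fun l m n => D (g l) (g m) (g n) := by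
  refine Finset.sum_congr rfl fun l hl => Finset.sum_congr rfl fun m hm => ?_
  simp only [Finset.mem_Ioo] at hl hm
  change D (f l) (f m) (f (s - l - m)) = D (g l) (g m) (g (s - l - m))
  rw [h l (by omega), h m (by omega), h (s - l - m) (by omega)]

lemma sum_Ioo_congr {M α : Type*} [AddCommMonoid M] (s : ℕ) {f g : ℕ → α}
    (h : ∀ m < s, f m = g m) (D : ℕ → α → α → M) :
    ∑ m ∈ Finset.Ioo 0 s, D m (f m) (f (s - m)) = ∑ m ∈ Finset.Ioo 0 s, D m (g m) (g (s - m)) := by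
  refine Finset.sum_congr rfl fun m hm => ?_
  simp only [Finset.mem_Ioo] at hm
  rw [h m (by omega), h (s - m) (by omega)]

lemma exists_majorant (Γ : ℝ) : ∃ A, IsMajorant Γ A := by
  refine exists_strong_rec (fun s A x => x = (if s = 1 then Γ else 0)
    + ∑ m ∈ Finset.Ioo 0 s, quadConst s * (A m * A (s - m))
    + tripleSum s fun l m n => 1 / 6 * (A l * (A m * A n))) ?_ fun n f _ => ⟨_, rfl⟩
  intro n f g x h hx
  rw [hx, sum_Ioo_congr n h fun _ x y => quadConst n * (x * y),
    tripleSum_congr n h fun x y z => 1 / 6 * (x * (y * z))]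

lemma quadConst_nonneg (s : ℕ) : 0 ≤ quadConst s := by
  unfold quadConst
  split_ifs <;> positivity

/-- The symmetrised weight has modulus at most 1/2, so its square plus 1/4 is at most 1/2. For `s =
2` only `m = 1` occurs, the weight is 0, and 1/4 remains. -/
lemma quadConst_sq {s m : ℕ} (hm : m ∈ Finset.Ioo 0 s) :
    (-((2 * m - s) / (2 * s) : ℝ)) ^ 2 + 1 / 4 ≤ quadConst s ^ 2 := by
  simp only [Finset.mem_Ioo] at hm
  unfold quadConst
  split_ifs with h
  · have : m = 1 := by omega
    subst h this
    norm_num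
  · have hs : (0 : ℝ) < s := by exact_mod_cast (by omega : 0 < s)
    have h1 : (m : ℝ) ≤ s := by exact_mod_cast hm.2.le
    have h2 : (0 : ℝ) ≤ m := by positivity
    have h3 : |((2 * m - s) / (2 * s) : ℝ)| ≤ 1 / 2 := by
      rw [abs_div, abs_of_pos (by positivity : (0 : ℝ) < 2 * s), div_le_iff₀ (by positivity), abs_le]
      constructor <;> linarith
    have h4 := pow_le_pow_left₀ (abs_nonneg _) h3 2
    rw [sq_abs] at h4
    rw [neg_sq, div_pow 1 (Real.sqrt 2), Real.sq_sqrt (by norm_num)]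
    linarith

/-- Exchanging `m` and `s - m` changes the sign of `gradCross`, so `m/s` may be averaged with `-(s -
m)/s`. -/
lemma sum_smul_gradCross (s : ℕ) (f : ℕ → E3 → E3) (a : E3) :
    ∑ m ∈ Finset.Ioo 0 s, (-((2 * m - s) / (2 * s) : ℝ)) • gradCross (f m) (f (s - m)) a
      = -∑ m ∈ Finset.Ioo 0 s, ((m : ℝ) / s) • gradCross (f m) (f (s - m)) a := by
  by_cases hs : s = 0
  · simp [hs]
  have hs' : (s : ℝ) ≠ 0 := by exact_mod_cast hs
  have h1 : ∑ m ∈ Finset.Ioo 0 s, ((m : ℝ) / s) • gradCross (f m) (f (s - m)) a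
      = ∑ m ∈ Finset.Ioo 0 s, (-((s - m : ℝ) / s)) • gradCross (f m) (f (s - m)) a := by
    rw [sum_Ioo_reflect]
    refine Finset.sum_congr rfl fun m hm => ?_
    simp only [Finset.mem_Ioo] at hm
    rw [Nat.sub_sub_self hm.2.le, gradCross_swap, smul_neg, neg_smul, Nat.cast_sub hm.2.le]
  have h2 : ∑ m ∈ Finset.Ioo 0 s, (-((2 * m - s) / (2 * s) : ℝ)) • gradCross (f m) (f (s - m)) a
      = (-(1 / 2) : ℝ) • (∑ m ∈ Finset.Ioo 0 s, ((m : ℝ) / s) • gradCross (f m) (f (s - m)) a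
        + ∑ m ∈ Finset.Ioo 0 s, (-((s - m : ℝ) / s)) • gradCross (f m) (f (s - m)) a) := by
    rw [← Finset.sum_add_distrib, Finset.smul_sum]
    refine Finset.sum_congr rfl fun m _ => ?_
    rw [← add_smul, smul_smul]
    congr 1
    field_simp
    ring
  rw [h2, ← h1]
  module

lemma sum_minorSum_symm (s : ℕ) (f : ℕ → E3 → E3) (a : E3) :
    ∑ m ∈ Finset.Ioo 0 s, 1 / 2 * (minorSum (f m) (f (s - m)) a + minorSum (f (s - m)) (f m) a)
      = ∑ m ∈ Finset.Ioo 0 s, minorSum (f m) (f (s - m)) a := by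
  have h1 : ∑ m ∈ Finset.Ioo 0 s, minorSum (f (s - m)) (f m) a
      = ∑ m ∈ Finset.Ioo 0 s, minorSum (f m) (f (s - m)) a := by
    rw [sum_Ioo_reflect]
    refine Finset.sum_congr rfl fun m hm => ?_
    simp only [Finset.mem_Ioo] at hm
    rw [Nat.sub_sub_self hm.2.le]
  rw [← Finset.mul_sum, Finset.sum_add_distrib, h1]
  ring

/-- Solution of the recurrence relation of order `s`. -/
lemma exists_next {v : E3 → E3} {Γ : ℝ} (hv : Good v Γ) (hdiv : ∀ a, divergence v a = 0)
    {A : ℕ → ℝ} (hA : IsMajorant Γ A) (s : ℕ) (f : ℕ → E3 → E3)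
    (hf : ∀ m < s, Good (f m) (A m)) :
    ∃ u, (s = 0 → u = 0) ∧ Good u (A s) ∧
      (∀ a, curl u a = (if s = 1 then curl v a else 0)
        - ∑ m ∈ Finset.Ioo 0 s, ((m : ℝ) / s) • gradCross (f m) (f (s - m)) a) ∧
      ∀ a, divergence u a = ∑ m ∈ Finset.Ioo 0 s, minorSum (f m) (f (s - m)) a
        - tripleSum s fun l m n => detMix (f l) (f m) (f n) a := by
  -- The range condition sits inside the existential so that `choose` yields a family over all
  -- indices, with junk value 0 outside the range.
  have hq : ∀ m, ∃ z, m ∈ Finset.Ioo 0 s → Good z (quadConst s * (A m * A (s - m))) ∧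
      (∀ a, curl z a = (-((2 * m - s) / (2 * s) : ℝ)) • gradCross (f m) (f (s - m)) a) ∧
      ∀ a, divergence z a
        = 1 / 2 * (minorSum (f m) (f (s - m)) a + minorSum (f (s - m)) (f m) a) := by
    intro m
    by_cases hm : m ∈ Finset.Ioo 0 s
    · have hm' := Finset.mem_Ioo.mp hm
      obtain ⟨z, hz⟩ := exists_good_quadratic (hf m (by omega)) (hf (s - m) (by omega))
        (quadConst_nonneg s) (quadConst_sq hm)
      exact ⟨z, fun _ => hz⟩
    · exact ⟨0, fun h => absurd h hm⟩
  have hc : ∀ l m, ∃ z, l ∈ Finset.Ioo 0 s → m ∈ Finset.Ioo 0 (s - l) →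
      Good z (1 / 6 * (A l * (A m * A (s - l - m)))) ∧ (∀ a, curl z a = 0) ∧
      ∀ a, divergence z a = -(1 / 6) * (detMix (f l) (f m) (f (s - l - m)) a
        + detMix (f m) (f (s - l - m)) (f l) a + detMix (f (s - l - m)) (f l) (f m) a
        + detMix (f m) (f l) (f (s - l - m)) a + detMix (f l) (f (s - l - m)) (f m) a
        + detMix (f (s - l - m)) (f m) (f l) a) := by
    intro l m
    by_cases hl : l ∈ Finset.Ioo 0 s
    · by_cases hm : m ∈ Finset.Ioo 0 (s - l)
      · have hl' := Finset.mem_Ioo.mp hl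
        have hm' := Finset.mem_Ioo.mp hm
        obtain ⟨z, hz⟩ := exists_good_cubic (hf l (by omega)) (hf m (by omega))
          (hf (s - l - m) (by omega))
        exact ⟨z, fun _ _ => hz⟩
      · exact ⟨0, fun _ h => absurd h hm⟩
    · exact ⟨0, fun h => absurd h hl⟩
  choose zq hzq using hq
  choose zc hzc using hc
  obtain ⟨q1, q2, q3⟩ := good_sum (Finset.Ioo 0 s) fun m hm => (hzq m hm).1
  have hin := fun l (hl : l ∈ Finset.Ioo 0 s) =>
    good_sum (Finset.Ioo 0 (s - l)) fun m hm => (hzc l m hl hm).1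
  obtain ⟨c1, c2, c3⟩ := good_sum (Finset.Ioo 0 s) fun l hl => (hin l hl).1
  have hw : Good (if s = 1 then v else 0) (if s = 1 then Γ else 0) := by
    split_ifs
    exacts [hv, good_zero]
  have d0 := hw.isPeriodicField.contDiff
  have d1 := q1.isPeriodicField.contDiff
  have d2 := c1.isPeriodicField.contDiff
  have d01 := (hw.add q1).isPeriodicField.contDiff
  refine ⟨(if s = 1 then v else 0) + ∑ m ∈ Finset.Ioo 0 s, zq m
    + ∑ l ∈ Finset.Ioo 0 s, ∑ m ∈ Finset.Ioo 0 (s - l), zc l m, ?_, ?_, fun a => ?_, fun a => ?_⟩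
  · rintro rfl
    simp
  · rw [hA s]
    exact (hw.add q1).add c1
  · rw [curl_add d01 d2, curl_add d0 d1, q2, c2, sub_eq_add_neg, ← sum_smul_gradCross,
      Finset.sum_congr rfl fun m hm => (hzq m hm).2.1 a]
    have h3 : ∑ l ∈ Finset.Ioo 0 s, curl (∑ m ∈ Finset.Ioo 0 (s - l), zc l m) a = 0 := by
      refine Finset.sum_eq_zero fun l hl => ?_
      rw [(hin l hl).2.1]
      exact Finset.sum_eq_zero fun m hm => (hzc l m hl hm).2.1 a
    rw [h3, add_zero]
    congr 1
    split_ifs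
    exacts [rfl, curl_zero a]
  · rw [divergence_add d01 d2, divergence_add d0 d1, q3, c3, ← sum_minorSum_symm,
      Finset.sum_congr rfl fun m hm => (hzq m hm).2.2 a]
    have h3 : ∑ l ∈ Finset.Ioo 0 s, divergence (∑ m ∈ Finset.Ioo 0 (s - l), zc l m) a
        = -tripleSum s fun l m n => detMix (f l) (f m) (f n) a := by
      have h4 := tripleSum_symm s fun l m n => detMix (f l) (f m) (f n) a
      have h5 : ∑ l ∈ Finset.Ioo 0 s, divergence (∑ m ∈ Finset.Ioo 0 (s - l), zc l m) a
          = -(1 / 6) * tripleSum s (fun l m n => detMix (f l) (f m) (f n) a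
            + detMix (f m) (f n) (f l) a + detMix (f n) (f l) (f m) a
            + detMix (f m) (f l) (f n) a + detMix (f l) (f n) (f m) a
            + detMix (f n) (f m) (f l) a) := by
        rw [tripleSum, Finset.mul_sum]
        refine Finset.sum_congr rfl fun l hl => ?_
        rw [(hin l hl).2.2, Finset.mul_sum]
        exact Finset.sum_congr rfl fun m hm => (hzc l m hl hm).2.2 a
      rw [h5, h4]
      ring
    have h6 : divergence (if s = 1 then v else 0) a = 0 := by
      split_ifs
      exacts [hdiv a, divergence_zero a]
    rw [h3, h6]
    ring

/-- Existence of the Taylor coefficients, with bounds. -/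
lemma exists_isTaylorCoefficients {v : E3 → E3} {Γ : ℝ} (hv : Good v Γ)
    (hdiv : ∀ a, divergence v a = 0) {A : ℕ → ℝ} (hA : IsMajorant Γ A) :
    ∃ ξ, IsTaylorCoefficients v ξ ∧ ∀ s, Good (ξ s) (A s) := by
  -- The relation carries the bound `A s` along with the equations: solvability at the next order
  -- needs it at all earlier ones.
  obtain ⟨ξ, hξ⟩ := exists_strong_rec (α := E3 → E3) (fun s f u => (s = 0 → u = 0) ∧ Good u (A s) ∧
      (∀ a, curl u a = (if s = 1 then curl v a else 0)
        - ∑ m ∈ Finset.Ioo 0 s, ((m : ℝ) / s) • gradCross (f m) (f (s - m)) a) ∧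
      ∀ a, divergence u a = ∑ m ∈ Finset.Ioo 0 s, minorSum (f m) (f (s - m)) a
        - tripleSum s fun l m n => detMix (f l) (f m) (f n) a) (by
      rintro n f g u h ⟨h0, h1, h2, h3⟩
      refine ⟨h0, h1, fun a => ?_, fun a => ?_⟩
      · rw [h2, sum_Ioo_congr n h fun m x y => ((m : ℝ) / n) • gradCross x y a]
      · rw [h3, sum_Ioo_congr n h fun _ x y => minorSum x y a,
          tripleSum_congr n h fun x y z => detMix x y z a])
    fun s f hf => exists_next hv hdiv hA s f fun m hm => (hf m hm).2.1
  exact ⟨ξ, ⟨(hξ 0).1 rfl, fun s _ => (hξ s).2.1.isPeriodicField, fun s _ => (hξ s).2.2.1,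
    fun s _ => (hξ s).2.2.2⟩, fun s => (hξ s).2.1⟩

/-- Uniqueness of the Taylor coefficients. -/
lemma IsTaylorCoefficients.unique {v : E3 → E3} {ξ η : ℕ → E3 → E3}
    (hξ : IsTaylorCoefficients v ξ) (hη : IsTaylorCoefficients v η) : ξ = η := by
  funext s
  induction s using Nat.strong_induction_on with
  | _ s ih =>
    rcases Nat.eq_zero_or_pos s with rfl | hs
    · rw [hξ.zero, hη.zero]
    refine (hξ.field s hs).ext_curl_div (hη.field s hs) (fun a => ?_) fun a => ?_
    · rw [hξ.curl_eq s hs, hη.curl_eq s hs,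
        sum_Ioo_congr s ih fun m x y => ((m : ℝ) / s) • gradCross x y a]
    · have h1 := hξ.div_eq s hs a
      have h2 := hη.div_eq s hs a
      have h3 := sum_Ioo_congr s ih fun _ x y => minorSum x y a
      have h4 := tripleSum_congr s ih fun x y z => detMix x y z a
      change _ = ∑ m ∈ Finset.Ioo 0 s, minorSum (ξ m) (ξ (s - m)) a
        - tripleSum s (fun l m n => detMix (ξ l) (ξ m) (ξ n) a) at h1
      change _ = ∑ m ∈ Finset.Ioo 0 s, minorSum (η m) (η (s - m)) a
        - tripleSum s (fun l m n => detMix (η l) (η m) (η n) a) at h2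
      rw [h1, h2, h3, h4]

end Recursion

/-! ### The majorant sequence and the critical time -/

section Majorants

lemma improvedCriticalTime_bounds :
    0.33254 < improvedCriticalTime ∧ improvedCriticalTime < 0.33255 := by
  have h1 : (1.414213 : ℝ) < Real.sqrt 2 := Real.lt_sqrt_of_sq_lt (by norm_num)
  have h2 : Real.sqrt 2 < 1.414214 := (Real.sqrt_lt' (by norm_num)).mpr (by norm_num)
  have h3 : (2.081665 : ℝ) < Real.sqrt (13 / 3) := Real.lt_sqrt_of_sq_lt (by norm_num)
  have h4 : Real.sqrt (13 / 3) < 2.081667 := (Real.sqrt_lt' (by norm_num)).mpr (by norm_num)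
  unfold improvedCriticalTime
  constructor <;> linarith

lemma criticalTime_bounds : 0.30964 < criticalTime ∧ criticalTime < 0.30965 := by
  have h1 : (1.414213 : ℝ) < Real.sqrt 2 := Real.lt_sqrt_of_sq_lt (by norm_num)
  have h2 : Real.sqrt 2 < 1.414214 := (Real.sqrt_lt' (by norm_num)).mpr (by norm_num)
  unfold criticalTime
  constructor <;> linarith

lemma one_div_sqrt_two : 1 / Real.sqrt 2 = Real.sqrt 2 / 2 := by
  have h := Real.mul_self_sqrt (show (0 : ℝ) ≤ 2 by norm_num)
  have : Real.sqrt 2 ≠ 0 := by positivity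
  field_simp
  linarith

/-- The improved critical time is the smaller root of this quadratic equation. -/
lemma improvedCriticalTime_eq :
    improvedCriticalTime + (1 / 2 - 1 / Real.sqrt 2) * improvedCriticalTime ^ 2 = criticalTime := by
  rw [one_div_sqrt_two]
  have h1 := Real.mul_self_sqrt (show (0 : ℝ) ≤ 2 by norm_num)
  have h2 := Real.mul_self_sqrt (show (0 : ℝ) ≤ 13 / 3 by norm_num)
  unfold improvedCriticalTime criticalTime
  set r := Real.sqrt 2
  set q := Real.sqrt (13 / 3)
  linear_combination (1 / 2 - r / 2) * h2 + (-(1 + r) / 2 + q) * h1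

lemma IsMajorant.nonneg {Γ : ℝ} {A : ℕ → ℝ} (hA : IsMajorant Γ A) (hΓ : 0 ≤ Γ) (s : ℕ) :
    0 ≤ A s := by
  induction s using Nat.strong_induction_on with
  | _ s ih =>
    rw [hA s]
    refine add_nonneg (add_nonneg (by split_ifs <;> simp [hΓ]) (Finset.sum_nonneg fun m hm => ?_))
      (Finset.sum_nonneg fun l hl => Finset.sum_nonneg fun m hm => ?_)
    · simp only [Finset.mem_Ioo] at hm
      exact mul_nonneg (quadConst_nonneg s) (mul_nonneg (ih m (by omega)) (ih _ (by omega)))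
    · simp only [Finset.mem_Ioo] at hl hm
      exact mul_nonneg (by norm_num) (mul_nonneg (ih l (by omega))
        (mul_nonneg (ih m (by omega)) (ih _ (by omega))))

/-- The recursion is homogeneous: the indices in every product add up to `s`. -/
lemma IsMajorant.scale {Γ : ℝ} {A : ℕ → ℝ} (hA : IsMajorant Γ A) (t : ℝ) :
    IsMajorant (t * Γ) fun s => A s * t ^ s := by
  intro s
  simp only
  rw [hA s, add_mul, add_mul, Finset.sum_mul]
  congr 1
  · congr 1
    · split_ifs with h
      · rw [h]; ring
      · ring
    · refine Finset.sum_congr rfl fun m hm => ?_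
      simp only [Finset.mem_Ioo] at hm
      rw [show t ^ s = t ^ m * t ^ (s - m) by rw [← pow_add]; congr 1; omega]
      ring
  · rw [tripleSum, tripleSum, Finset.sum_mul]
    refine Finset.sum_congr rfl fun l hl => ?_
    rw [Finset.sum_mul]
    refine Finset.sum_congr rfl fun m hm => ?_
    simp only [Finset.mem_Ioo] at hl hm
    rw [show t ^ s = t ^ l * (t ^ m * t ^ (s - l - m)) by rw [← pow_add, ← pow_add]; congr 1; omega]
    ring

/-- Both indices are at least 1, so orders up to `N` involve only factors of order below `N`. This
shift closes the induction on partial sums. -/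
lemma sum_conv_le {b c : ℕ → ℝ} (hb : ∀ n, 0 ≤ b n) (hc : ∀ n, 0 ≤ c n) (N : ℕ) :
    ∑ s ∈ Finset.range (N + 1), ∑ m ∈ Finset.Ioo 0 s, b m * c (s - m)
      ≤ (∑ m ∈ Finset.range N, b m) * ∑ n ∈ Finset.range N, c n := by
  rw [Finset.sum_comm' (t' := Finset.Ioo 0 N) (s' := fun m => Finset.Ioo m (N + 1))]
  · rw [Finset.sum_mul]
    have h1 : ∀ m ∈ Finset.Ioo 0 N, ∑ s ∈ Finset.Ioo m (N + 1), b m * c (s - m)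
        ≤ b m * ∑ n ∈ Finset.range N, c n := by
      intro m hm
      rw [← Finset.mul_sum]
      refine mul_le_mul_of_nonneg_left ?_ (hb m)
      have hinj : Set.InjOn (fun s => s - m) (Finset.Ioo m (N + 1) : Set ℕ) := by
        intro x hx y hy hxy
        simp only [Finset.coe_Ioo, Set.mem_Ioo] at hx hy hxy
        omega
      rw [← Finset.sum_image (g := fun s => s - m) (f := c) hinj]
      refine Finset.sum_le_sum_of_subset_of_nonneg ?_ fun n _ _ => hc n
      intro n hn
      simp only [Finset.mem_image, Finset.mem_Ioo, Finset.mem_range] at hn hm ⊢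
      omega
    refine (Finset.sum_le_sum h1).trans ?_
    refine Finset.sum_le_sum_of_subset_of_nonneg ?_ fun m _ _ =>
      mul_nonneg (hb m) (Finset.sum_nonneg fun n _ => hc n)
    intro m hm
    simp only [Finset.mem_Ioo, Finset.mem_range] at hm ⊢
    omega
  · intro s m
    simp only [Finset.mem_Ioo, Finset.mem_range]
    omega

lemma IsMajorant.one {T : ℝ} {B : ℕ → ℝ} (hB : IsMajorant T B) : B 1 = T := by
  have h : Finset.Ioo 0 1 = ∅ := by decide
  rw [hB 1]
  simp [tripleSum, h]

lemma IsMajorant.zero {T : ℝ} {B : ℕ → ℝ} (hB : IsMajorant T B) : B 0 = 0 := by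
  rw [hB 0]
  simp [tripleSum]

/-- Partial-sum form of the cubic equation for the generating function. The order 2 correction is
negative, so it is kept exactly, with `B 1 = T`; `2 ≤ N` ensures that it is present in the sum. -/
lemma IsMajorant.sum_succ_le {T : ℝ} {B : ℕ → ℝ} (hB : IsMajorant T B) (hT : 0 ≤ T) {N : ℕ}
    (hN : 2 ≤ N) : ∑ s ∈ Finset.range (N + 1), B s
      ≤ T + (1 / 2 - 1 / Real.sqrt 2) * T ^ 2
        + 1 / Real.sqrt 2 * (∑ s ∈ Finset.range N, B s) ^ 2
        + 1 / 6 * (∑ s ∈ Finset.range N, B s) ^ 3 := by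
  have hnn := hB.nonneg hT
  set S := ∑ s ∈ Finset.range N, B s with hS
  have hS0 : 0 ≤ S := Finset.sum_nonneg fun n _ => hnn n
  let conv : ℕ → ℝ := fun s => ∑ m ∈ Finset.Ioo 0 s, B m * B (s - m)
  have hconv0 : ∀ s, 0 ≤ conv s := fun s =>
    Finset.sum_nonneg fun m _ => mul_nonneg (hnn _) (hnn _)
  have hrec : ∀ s, B s = (if s = 1 then T else 0)
      + (1 / Real.sqrt 2 * conv s + if s = 2 then (1 / 2 - 1 / Real.sqrt 2) * T ^ 2 else 0)
      + 1 / 6 * ∑ l ∈ Finset.Ioo 0 s, B l * conv (s - l) := by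
    intro s
    rw [hB s]
    congr 1
    · congr 1
      rw [← Finset.mul_sum]
      split_ifs with h
      · subst h
        have : Finset.Ioo 0 2 = {1} := by decide
        simp only [quadConst, conv, this, Finset.sum_singleton, if_true, hB.one]
        ring
      · simp [quadConst, h, conv]
    · rw [tripleSum, Finset.mul_sum]
      refine Finset.sum_congr rfl fun l _ => ?_
      simp only [conv, Finset.mul_sum]
  have h1 : ∑ s ∈ Finset.range (N + 1), conv s ≤ S ^ 2 := by
    rw [sq]
    exact sum_conv_le hnn hnn N
  have h2 : ∑ s ∈ Finset.range N, conv s ≤ S ^ 2 :=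
    (Finset.sum_le_sum_of_subset_of_nonneg (Finset.range_mono (Nat.le_succ N))
      fun n _ _ => hconv0 n).trans h1
  have h3 : ∑ s ∈ Finset.range (N + 1), ∑ l ∈ Finset.Ioo 0 s, B l * conv (s - l) ≤ S ^ 3 := by
    refine (sum_conv_le hnn hconv0 N).trans ?_
    calc S * ∑ n ∈ Finset.range N, conv n ≤ S * S ^ 2 := mul_le_mul_of_nonneg_left h2 hS0
      _ = S ^ 3 := by ring
  rw [Finset.sum_congr rfl fun s _ => hrec s, Finset.sum_add_distrib, Finset.sum_add_distrib,
    Finset.sum_add_distrib, ← Finset.mul_sum, ← Finset.mul_sum, Finset.sum_ite_eq',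
    Finset.sum_ite_eq', if_pos (Finset.mem_range.mpr (by omega)),
    if_pos (Finset.mem_range.mpr (by omega))]
  have h4 : 1 / Real.sqrt 2 * ∑ s ∈ Finset.range (N + 1), conv s ≤ 1 / Real.sqrt 2 * S ^ 2 :=
    mul_le_mul_of_nonneg_left h1 (by positivity)
  linarith

/-- The increasing map `x ↦ T_c + x²/√2 + x³/6` fixes `2 - √2`, where it is tangent to the diagonal,
so it preserves the interval from 0 to that point. -/
lemma IsMajorant.sum_le {T : ℝ} {B : ℕ → ℝ} (hB : IsMajorant T B) (hT : 0 ≤ T)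
    (hTc : T ≤ improvedCriticalTime) (N : ℕ) :
    ∑ s ∈ Finset.range N, B s ≤ 2 - Real.sqrt 2 := by
  have hnn := hB.nonneg hT
  have hc := improvedCriticalTime_bounds
  have h1 : (1.4142 : ℝ) < Real.sqrt 2 := Real.lt_sqrt_of_sq_lt (by norm_num)
  have h2 : Real.sqrt 2 < 1.4143 := (Real.sqrt_lt' (by norm_num)).mpr (by norm_num)
  have hr := Real.mul_self_sqrt (show (0 : ℝ) ≤ 2 by norm_num)
  induction N with
  | zero => simp
  | succ N ih =>
    by_cases hN : 2 ≤ N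
    · refine (hB.sum_succ_le hT hN).trans ?_
      set S := ∑ s ∈ Finset.range N, B s
      have hS0 : 0 ≤ S := Finset.sum_nonneg fun n _ => hnn n
      -- The quadratic increases up to the improved critical time, which is well before its vertex;
      -- the difference of its values factors as below.
      have h3 : T + (1 / 2 - 1 / Real.sqrt 2) * T ^ 2 ≤ criticalTime := by
        rw [← improvedCriticalTime_eq, one_div_sqrt_two]
        set Tc := improvedCriticalTime
        have : 0 ≤ (Tc - T) * (1 + (1 / 2 - Real.sqrt 2 / 2) * (Tc + T)) := by
          refine mul_nonneg (by linarith) ?_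
          nlinarith
        linarith
      have h4 : S ^ 2 ≤ (2 - Real.sqrt 2) ^ 2 := pow_le_pow_left₀ hS0 ih 2
      have h5 : S ^ 3 ≤ (2 - Real.sqrt 2) ^ 3 := pow_le_pow_left₀ hS0 ih 3
      have h6 : 1 / Real.sqrt 2 * S ^ 2 ≤ 1 / Real.sqrt 2 * (2 - Real.sqrt 2) ^ 2 :=
        mul_le_mul_of_nonneg_left h4 (by positivity)
      have h7 : criticalTime + 1 / Real.sqrt 2 * (2 - Real.sqrt 2) ^ 2
          + 1 / 6 * (2 - Real.sqrt 2) ^ 3 = 2 - Real.sqrt 2 := by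
        rw [one_div_sqrt_two, criticalTime]
        set r := Real.sqrt 2
        linear_combination (r / 2 - 2 + 1 - r / 6) * hr
      linarith
    · have : N = 0 ∨ N = 1 := by omega
      rcases this with rfl | rfl
      · simp [hB.zero]
      · simp [Finset.sum_range_succ, hB.zero, hB.one]; linarith

lemma IsMajorant.summable {Γ : ℝ} {A : ℕ → ℝ} (hA : IsMajorant Γ A) (hΓ : 0 ≤ Γ) {t : ℝ}
    (ht : 0 ≤ t) (htc : t * Γ ≤ improvedCriticalTime) : Summable fun s => A s * t ^ s :=
  summable_of_sum_range_le (fun s => mul_nonneg (hA.nonneg hΓ s) (pow_nonneg ht s))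
    ((hA.scale t).sum_le (mul_nonneg ht hΓ) htc)

/-- Bernoulli's inequality for the power `(t₂/t₁)^s`. -/
lemma exists_nat_mul_pow_le {t₁ t₂ : ℝ} (h1 : 0 < t₁) (h2 : t₁ < t₂) :
    ∃ K, ∀ s : ℕ, (s : ℝ) * t₁ ^ (s - 1) ≤ K * t₂ ^ s := by
  have hε : 0 < t₂ / t₁ - 1 := by rw [sub_pos, lt_div_iff₀ h1]; linarith
  refine ⟨1 / ((t₂ / t₁ - 1) * t₁), fun s => ?_⟩
  rcases s.eq_zero_or_pos with rfl | hs
  · simp; positivity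
  have h3 := one_add_mul_le_pow (show (-2 : ℝ) ≤ t₂ / t₁ - 1 by linarith) s
  rw [add_sub_cancel, div_pow, le_div_iff₀ (by positivity)] at h3
  have h4 : t₁ ^ s = t₁ ^ (s - 1) * t₁ := by rw [← pow_succ]; congr 1; omega
  rw [div_mul_eq_mul_div, le_div_iff₀ (by positivity), one_mul]
  have h5 : 0 ≤ t₁ ^ s := by positivity
  calc (s : ℝ) * t₁ ^ (s - 1) * ((t₂ / t₁ - 1) * t₁) = s * (t₂ / t₁ - 1) * t₁ ^ s := by
        rw [h4]; ring
    _ ≤ t₂ ^ s := by nlinarith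

lemma IsMajorant.summable_deriv {Γ : ℝ} {A : ℕ → ℝ} (hA : IsMajorant Γ A) (hΓ : 0 ≤ Γ) {t : ℝ}
    (ht : 0 ≤ t) (htc : t * Γ < improvedCriticalTime) :
    Summable fun s : ℕ => A s * (s * t ^ (s - 1)) := by
  obtain ⟨t₁, t₂, h1, h2, h3, h4⟩ : ∃ t₁ t₂ : ℝ, t ≤ t₁ ∧ 0 < t₁ ∧ t₁ < t₂ ∧
      t₂ * Γ ≤ improvedCriticalTime := by
    -- Dividing by `Γ + 1` rather than `Γ` covers `Γ = 0`. The strict inequality leaves room for a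
    -- larger time, whose powers absorb the factor `s`.
    have hε : 0 < (improvedCriticalTime - t * Γ) / (Γ + 1) := div_pos (by linarith) (by linarith)
    set ε := (improvedCriticalTime - t * Γ) / (Γ + 1) with hεd
    have h5 : ε * (Γ + 1) = improvedCriticalTime - t * Γ := by
      rw [hεd]; field_simp
    exact ⟨t + ε / 2, t + ε, by linarith, by linarith, by linarith, by nlinarith⟩
  obtain ⟨K, hK⟩ := exists_nat_mul_pow_le h2 h3
  have hs := (hA.summable hΓ (by linarith) h4).mul_left K
  refine Summable.of_nonneg_of_le (fun s => ?_) (fun s => ?_) hs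
  · exact mul_nonneg (hA.nonneg hΓ s) (by positivity)
  · have h5 : (s : ℝ) * t ^ (s - 1) ≤ s * t₁ ^ (s - 1) := by gcongr
    calc A s * (s * t ^ (s - 1)) ≤ A s * (K * t₂ ^ s) :=
          mul_le_mul_of_nonneg_left (h5.trans (hK s)) (hA.nonneg hΓ s)
      _ = K * (A s * t₂ ^ s) := by ring

end Majorants

/-! ### Summation of the series and verification of Cauchy's equations -/

section CauchySolution

/-- Cauchy products of absolutely convergent series without terms of order zero. -/
lemma hasSum_conv {b c : ℕ → ℝ} {x y : ℝ} (hb0 : b 0 = 0) (hc0 : c 0 = 0) (hb : HasSum b x)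
    (hc : HasSum c y) (hbs : Summable fun n => ‖b n‖) (hcs : Summable fun n => ‖c n‖) :
    HasSum (fun s => ∑ m ∈ Finset.Ioo 0 s, b m * c (s - m)) (x * y) ∧
      Summable fun s => ‖∑ m ∈ Finset.Ioo 0 s, b m * c (s - m)‖ := by
  have h1 : ∀ s, ∑ kl ∈ Finset.HasAntidiagonal.antidiagonal s, b kl.1 * c kl.2
      = ∑ m ∈ Finset.Ioo 0 s, b m * c (s - m) := by
    intro s
    rw [Finset.Nat.sum_antidiagonal_eq_sum_range_succ_mk]
    symm
    refine Finset.sum_subset (fun m hm => ?_) fun m hm hm' => ?_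
    · simp only [Finset.mem_Ioo, Finset.mem_range] at hm ⊢
      omega
    · simp only [Finset.mem_Ioo, Finset.mem_range] at hm hm'
      -- The full Cauchy product has two more terms, which vanish with the order zero terms.
      have : m = 0 ∨ s - m = 0 := by omega
      rcases this with h | h
      · simp [h, hb0]
      · simp [h, hc0]
  have h2 := summable_norm_sum_mul_antidiagonal_of_summable_norm hbs hcs
  have h3 := tsum_mul_tsum_eq_tsum_sum_antidiagonal_of_summable_norm hbs hcs
  rw [hb.tsum_eq, hc.tsum_eq] at h3
  simp only [h1] at h2 h3
  exact ⟨h3 ▸ h2.of_norm.hasSum, h2⟩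

section Weighted

variable {ξ : ℕ → E3 → E3} {A : ℕ → ℝ}

/-- The sum of the fields `ξ s` with weights `w s`. -/
def weightedSum (ξ : ℕ → E3 → E3) (w : ℕ → ℝ) (a : E3) : E3 := ∑' s, w s • ξ s a

lemma norm_jac_le {u : E3 → E3} {K : ℝ} (hu : Good u K) (a : E3) (i j : Fin 3) :
    ‖jac u a i j‖ ≤ K := by
  refine (PiLp.norm_apply_le (fderiv ℝ u a (EuclideanSpace.single i 1)) j).trans ?_
  refine ((fderiv ℝ u a).le_of_opNorm_le (hu.norm_fderiv_le a) _).trans ?_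
  simp

/-- Weights `t ^ s` give the displacement and `s * t ^ (s - 1)` the velocity, so one statement
covers both. -/
lemma weightedSum_contDiff (hξ : ∀ s, Good (ξ s) (A s)) {w : ℕ → ℝ}
    (hw : Summable fun s => A s * |w s|) :
    ContDiff ℝ 1 (weightedSum ξ w) ∧ ∀ a, HasFDerivAt (weightedSum ξ w)
      (∑' s, w s • fderiv ℝ (ξ s) a) a := by
  have hc := fun s => (hξ s).isPeriodicField.contDiff
  refine contDiff_one_tsum hw hw (f := fun s a => w s • ξ s a)
    (f' := fun s a => w s • fderiv ℝ (ξ s) a) (fun s a => ?_) (fun s => ?_) (fun s a => ?_)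
    (fun s a => ?_)
  · exact (((hc s).differentiable one_ne_zero) a).hasFDerivAt.const_smul (w s)
  · exact ((hc s).continuous_fderiv one_ne_zero).const_smul (w s)
  · rw [norm_smul, Real.norm_eq_abs, mul_comm]
    exact mul_le_mul_of_nonneg_right ((hξ s).norm_le a) (abs_nonneg _)
  · rw [norm_smul, Real.norm_eq_abs, mul_comm]
    exact mul_le_mul_of_nonneg_right ((hξ s).norm_fderiv_le a) (abs_nonneg _)

lemma summable_norm_weighted_jac (hξ : ∀ s, Good (ξ s) (A s)) {w : ℕ → ℝ}
    (hw : Summable fun s => A s * |w s|) (a : E3) (i j : Fin 3) :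
    Summable fun s => ‖w s * jac (ξ s) a i j‖ := by
  refine Summable.of_nonneg_of_le (fun _ => norm_nonneg _) (fun s => ?_) hw
  rw [norm_mul, Real.norm_eq_abs, mul_comm]
  exact mul_le_mul_of_nonneg_right (norm_jac_le (hξ s) a i j) (abs_nonneg _)

lemma hasSum_jac_weightedSum (hξ : ∀ s, Good (ξ s) (A s)) {w : ℕ → ℝ}
    (hw : Summable fun s => A s * |w s|) (a : E3) (i j : Fin 3) :
    HasSum (fun s => w s * jac (ξ s) a i j) (jac (weightedSum ξ w) a i j) := by
  have h0 : Summable fun s => w s • fderiv ℝ (ξ s) a := by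
    refine Summable.of_norm_bounded hw fun s => ?_
    rw [norm_smul, Real.norm_eq_abs, mul_comm]
    exact mul_le_mul_of_nonneg_right ((hξ s).norm_fderiv_le a) (abs_nonneg _)
  have h1 := h0.hasSum.mapL (ContinuousLinearMap.apply ℝ E3 (EuclideanSpace.single i 1 : E3))
  have h2 := h1.mapL (EuclideanSpace.proj (𝕜 := ℝ) j : E3 →L[ℝ] ℝ)
  rw [jac, Matrix.of_apply, ((weightedSum_contDiff hξ hw).2 a).fderiv]
  exact h2

lemma weightedSum_isPeriodicField (hξ : ∀ s, Good (ξ s) (A s)) {w : ℕ → ℝ}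
    (hw : Summable fun s => A s * |w s|) : IsPeriodicField (weightedSum ξ w) where
  contDiff := (weightedSum_contDiff hξ hw).1
  periodic a k := by
    simp only [weightedSum]
    exact tsum_congr fun s => by rw [(hξ s).isPeriodicField.periodic a k]
  mean_zero := by
    have hp := fun s => (hξ s).isPeriodicField
    have hvol : volume cell ≠ ⊤ := isCompact_cell.measure_lt_top.ne
    have hint : ∀ s, Integrable (fun a => w s • ξ s a) (volume.restrict cell) := fun s =>
      ((hp s).contDiff.continuous.const_smul (w s)).continuousOn.integrableOn_compact
        isCompact_cell
    have hle : ∀ s, ∫ a in cell, ‖w s • ξ s a‖ ≤ (A s * |w s|) * volume.real cell := by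
      intro s
      have h1 : ∀ a, ‖w s • ξ s a‖ ≤ A s * |w s| := fun a => by
        rw [norm_smul, Real.norm_eq_abs, mul_comm]
        exact mul_le_mul_of_nonneg_right ((hξ s).norm_le a) (abs_nonneg _)
      have h2 := integral_mono (hint s).norm (integrableOn_const hvol (C := A s * |w s|)) h1
      refine h2.trans (le_of_eq ?_)
      rw [setIntegral_const, smul_eq_mul, mul_comm]
    have hs : Summable fun s => ∫ a in cell, ‖w s • ξ s a‖ :=
      Summable.of_nonneg_of_le (fun s => integral_nonneg fun a => norm_nonneg _) hle
        (hw.mul_right _)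
    have h := integral_tsum_of_summable_integral_norm hint hs
    simp only [weightedSum]
    rw [← h]
    simp [integral_smul, (hp _).mean_zero]

end Weighted

lemma jac_id (a : E3) : jac (fun a => a) a = 1 := by
  ext i j
  simp only [jac, Matrix.of_apply, fderiv_fun_id]
  by_cases h : j = i
  · subst h; simp
  · simp [h, Ne.symm h]

lemma jac_id_add {u : E3 → E3} (hu : ContDiff ℝ 1 u) (a : E3) :
    jac (fun a => a + u a) a = 1 + jac u a := by
  have := jac_add (u := fun a => a) contDiff_id hu a
  rw [jac_id] at this
  exact this

section Solution

variable {v : E3 → E3} {ξ : ℕ → E3 → E3} {A : ℕ → ℝ} {Γ t : ℝ}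

lemma summable_weight (hA : IsMajorant Γ A) (hΓ : 0 ≤ Γ)
    (ht : |t| * Γ < improvedCriticalTime) : Summable fun s => A s * |t ^ s| := by
  simpa only [abs_pow] using hA.summable hΓ (abs_nonneg t) ht.le

lemma summable_weight_deriv (hA : IsMajorant Γ A) (hΓ : 0 ≤ Γ)
    (ht : |t| * Γ < improvedCriticalTime) :
    Summable fun s : ℕ => A s * |(s : ℝ) * t ^ (s - 1)| := by
  simpa only [abs_mul, abs_pow, Nat.abs_cast] using hA.summable_deriv hΓ (abs_nonneg t) ht

/-- Termwise differentiation needs a uniform bound near `t`; the derived majorant series at a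
slightly larger time `t₁` provides it on `(-t₁, t₁)`. -/
lemma hasDerivAt_lagrangianMap (hA : IsMajorant Γ A) (hΓ : 0 ≤ Γ) (hξ : ∀ s, Good (ξ s) (A s))
    (ht : |t| * Γ < improvedCriticalTime) (a : E3) :
    HasDerivAt (fun τ => lagrangianMap ξ τ a) (weightedSum ξ (fun s => s * t ^ (s - 1)) a) t := by
  obtain ⟨t₁, h1, h2⟩ : ∃ t₁ : ℝ, |t| < t₁ ∧ t₁ * Γ < improvedCriticalTime := by
    have hε : 0 < (improvedCriticalTime - |t| * Γ) / (Γ + 1) := div_pos (by linarith) (by linarith)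
    set ε := (improvedCriticalTime - |t| * Γ) / (Γ + 1) with hεd
    have h5 : ε * (Γ + 1) = improvedCriticalTime - |t| * Γ := by
      rw [hεd]; field_simp
    exact ⟨|t| + ε, by linarith, by linarith⟩
  have ht1 : 0 < t₁ := (abs_nonneg t).trans_lt h1
  have hmem : t ∈ Set.Ioo (-t₁) t₁ := abs_lt.mp h1
  have hbd : Summable fun s : ℕ => A s * (s * t₁ ^ (s - 1)) := hA.summable_deriv hΓ ht1.le h2
  refine HasDerivAt.const_add a ?_
  refine hasDerivAt_tsum_of_isPreconnected hbd isOpen_Ioo isPreconnected_Ioo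
    (g := fun s τ => τ ^ s • ξ s a) (g' := fun s τ => ((s : ℝ) * τ ^ (s - 1)) • ξ s a)
    (fun s τ _ => (hasDerivAt_pow s τ).smul_const (ξ s a)) (fun s τ hτ => ?_) hmem ?_ hmem
  · rw [norm_smul, mul_comm, Real.norm_eq_abs, abs_mul, abs_pow, Nat.abs_cast]
    have h3 : |τ| ≤ t₁ := (abs_lt.mpr hτ).le
    have h4 := (hξ s).nonneg
    gcongr
    exact (hξ s).norm_le a
  · refine Summable.of_norm_bounded (summable_weight hA hΓ ht) fun s => ?_
    rw [norm_smul, Real.norm_eq_abs, mul_comm]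
    exact mul_le_mul_of_nonneg_right ((hξ s).norm_le a) (abs_nonneg _)

lemma IsTaylorCoefficients.one_eq (h : IsTaylorCoefficients v ξ) (hv : IsInitialVelocity v) :
    ξ 1 = v := by
  have he : Finset.Ioo 0 1 = ∅ := by decide
  refine (h.field 1 le_rfl).ext_curl_div hv.toIsPeriodicField (fun a => ?_) fun a => ?_
  · rw [h.curl_eq 1 le_rfl, he]
    simp
  · rw [h.div_eq 1 le_rfl, hv.div_eq_zero, he]
    simp

/-- With `∇x = 1 + ∇ξ` the identity part gives the curl of the velocity and the rest is a Cauchy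
product. The terms in `t ^ (s - 1)` together are `s` times the curl relation of order `s`. -/
lemma gradCross_lagrangianMap (h : IsTaylorCoefficients v ξ) (hA : IsMajorant Γ A) (hΓ : 0 ≤ Γ)
    (hξ : ∀ s, Good (ξ s) (A s)) (ht : |t| * Γ < improvedCriticalTime) (a : E3) :
    gradCross (weightedSum ξ fun s => s * t ^ (s - 1)) (lagrangianMap ξ t) a = curl v a := by
  have hw := summable_weight hA hΓ ht
  have hw' := summable_weight_deriv hA hΓ ht
  have hX : jac (lagrangianMap ξ t) a = 1 + jac (weightedSum ξ fun s => t ^ s) a :=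
    jac_id_add (weightedSum_contDiff hξ hw).1 a
  have hJ := hasSum_jac_weightedSum hξ hw a
  have hV := hasSum_jac_weightedSum hξ hw' a
  have hJs := summable_norm_weighted_jac hξ hw a
  have hVs := summable_norm_weighted_jac hξ hw' a
  have hj0 : ∀ i j, jac (ξ 0) a i j = 0 := fun i j => by rw [h.zero, jac_zero]; rfl
  have hprod := fun i k j l => (hasSum_conv (by simp) (by simp [hj0]) (hV i k) (hJ j l) (hVs i k)
    (hJs j l)).1
  set V := weightedSum ξ fun s : ℕ => (s : ℝ) * t ^ (s - 1)
  set W := weightedSum ξ fun s : ℕ => t ^ s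
  have key : ∀ (i j l : Fin 3), (∀ u : E3 → E3, curl u a l = jac u a i j - jac u a j i) →
      (∀ u w : E3 → E3, gradCross u w a l = ∑ k, (jac u a i k * jac w a j k
        - jac u a j k * jac w a i k)) →
      gradCross V (lagrangianMap ξ t) a l = curl v a l := by
    intro i j l hcurl hcross
    have h1 := ((hV i j).sub (hV j i)).add (hasSum_sum (s := Finset.univ)
      fun k (_ : k ∈ Finset.univ) => (hprod i k j k).sub (hprod j k i k))
    have h2 : HasSum (fun s : ℕ => if s = 1 then curl v a l else 0) (curl v a l) :=
      hasSum_ite_eq 1 (curl v a l)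
    have h3 := h1.unique (h2.congr_fun fun s => ?_)
    · rw [← h3, hcross, hX]
      simp only [Matrix.add_apply, mul_add, Finset.sum_sub_distrib, Finset.sum_add_distrib,
        Matrix.one_apply, mul_ite, mul_one, mul_zero, Finset.sum_ite_eq, Finset.mem_univ, if_true]
      ring
    · rcases s.eq_zero_or_pos with rfl | hs
      · simp
      have hs' : (s : ℝ) ≠ 0 := by exact_mod_cast hs.ne'
      have h4 := congrArg (fun x : E3 => x l) (h.curl_eq s hs a)
      simp only [PiLp.sub_apply, WithLp.ofLp_sum, Finset.sum_apply, PiLp.smul_apply, smul_eq_mul,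
        hcurl (ξ s), hcross] at h4
      have h5 : ∀ i j, ∑ k, ∑ m ∈ Finset.Ioo 0 s, (m : ℝ) * t ^ (m - 1) * jac (ξ m) a i k
          * (t ^ (s - m) * jac (ξ (s - m)) a j k)
          = s * t ^ (s - 1) * ∑ m ∈ Finset.Ioo 0 s, (m : ℝ) / s *
            ∑ k, jac (ξ m) a i k * jac (ξ (s - m)) a j k := by
        intro i j
        rw [Finset.sum_comm, Finset.mul_sum]
        refine Finset.sum_congr rfl fun m hm => ?_
        rw [Finset.mul_sum, Finset.mul_sum]
        refine Finset.sum_congr rfl fun k _ => ?_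
        simp only [Finset.mem_Ioo] at hm
        rw [show t ^ (s - 1) = t ^ (m - 1) * t ^ (s - m) by rw [← pow_add]; congr 1; omega]
        field_simp
      have h6 : ∑ m ∈ Finset.Ioo 0 s, (m : ℝ) / s * ∑ k, (jac (ξ m) a i k * jac (ξ (s - m)) a j k
            - jac (ξ m) a j k * jac (ξ (s - m)) a i k)
          = ∑ m ∈ Finset.Ioo 0 s, (m : ℝ) / s * ∑ k, jac (ξ m) a i k * jac (ξ (s - m)) a j k
            - ∑ m ∈ Finset.Ioo 0 s, (m : ℝ) / s *
              ∑ k, jac (ξ m) a j k * jac (ξ (s - m)) a i k := by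
        rw [← Finset.sum_sub_distrib]
        refine Finset.sum_congr rfl fun m _ => ?_
        rw [Finset.sum_sub_distrib]
        ring
      rw [h6] at h4
      rw [Finset.sum_sub_distrib, h5, h5]
      -- Only order 1 sees the initial vorticity; there the weight is 1 and the convolution is
      -- empty.
      by_cases hs1 : s = 1
      · subst hs1
        simp at h4 ⊢
        linarith
      · simp only [hs1, if_false, PiLp.zero_apply] at h4 ⊢
        linear_combination (s * t ^ (s - 1) : ℝ) * h4
  ext l
  fin_cases l
  · exact key 1 2 0 (fun u => by simp [curl]) fun u w => by simp [gradCross_apply]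
  · exact key 2 0 1 (fun u => by simp [curl]) fun u w => by simp [gradCross_apply]
  · exact key 0 1 2 (fun u => by simp [curl]) fun u w => by simp [gradCross_apply]

/-- `det (1 + J)` is 1 plus the trace, plus the principal 2 × 2 minors, plus `det J`; `minorSum` is
minus the sum of these minors. The divergence relations cancel everything beyond 1 order by order.
-/
lemma det_lagrangianMap (h : IsTaylorCoefficients v ξ) (hA : IsMajorant Γ A) (hΓ : 0 ≤ Γ)
    (hξ : ∀ s, Good (ξ s) (A s)) (ht : |t| * Γ < improvedCriticalTime) (a : E3) :
    (jac (lagrangianMap ξ t) a).det = 1 := by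
  have hw := summable_weight hA hΓ ht
  have hX : jac (lagrangianMap ξ t) a = 1 + jac (weightedSum ξ fun s => t ^ s) a :=
    jac_id_add (weightedSum_contDiff hξ hw).1 a
  have hJ := hasSum_jac_weightedSum hξ hw a
  have hJs := summable_norm_weighted_jac hξ hw a
  have hj0 : ∀ i j, jac (ξ 0) a i j = 0 := fun i j => by rw [h.zero, jac_zero]; rfl
  have hj0' : ∀ i j, t ^ 0 * jac (ξ 0) a i j = 0 := fun i j => by rw [hj0, mul_zero]
  have h2 := fun i j k l => hasSum_conv (hj0' i j) (hj0' k l) (hJ i j) (hJ k l) (hJs i j) (hJs k l)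
  have h3 := fun i j k l m n => (hasSum_conv (hj0' i j) (by simp) (hJ i j) (h2 k l m n).1 (hJs i j)
    (h2 k l m n).2).1
  have hq : HasSum (fun s => t ^ s * ∑ m ∈ Finset.Ioo 0 s, minorSum (ξ m) (ξ (s - m)) a)
      (minorSum (weightedSum ξ fun s => t ^ s) (weightedSum ξ fun s => t ^ s) a) := by
    have h4 := ((((h2 1 0 0 1).1.sub (h2 0 0 1 1).1)).add ((h2 2 0 0 2).1.sub (h2 0 0 2 2).1)).add
      ((h2 2 1 1 2).1.sub (h2 1 1 2 2).1)
    rw [minorSum_eq]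
    refine h4.congr_fun fun s => ?_
    simp only [← Finset.sum_sub_distrib, ← Finset.sum_add_distrib, Finset.mul_sum]
    refine Finset.sum_congr rfl fun m hm => ?_
    simp only [Finset.mem_Ioo] at hm
    rw [minorSum_eq, show t ^ s = t ^ m * t ^ (s - m) by rw [← pow_add]; congr 1; omega]
    ring
  have hc : HasSum (fun s => t ^ s * tripleSum s fun l m n => detMix (ξ l) (ξ m) (ξ n) a)
      (detMix (weightedSum ξ fun s => t ^ s) (weightedSum ξ fun s => t ^ s)
        (weightedSum ξ fun s => t ^ s) a) := by
    have h4 := (((((h3 0 0 1 1 2 2).sub (h3 0 0 2 1 1 2)).sub (h3 1 0 0 1 2 2)).add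
      (h3 1 0 2 1 0 2)).add (h3 2 0 0 1 1 2)).sub (h3 2 0 1 1 0 2)
    rw [detMix_eq]
    refine h4.congr_fun fun s => ?_
    simp only [tripleSum, ← Finset.sum_sub_distrib, ← Finset.sum_add_distrib, Finset.mul_sum]
    refine Finset.sum_congr rfl fun l hl => Finset.sum_congr rfl fun m hm => ?_
    simp only [Finset.mem_Ioo] at hl hm
    rw [detMix_eq, show t ^ s = t ^ l * (t ^ m * t ^ (s - l - m)) by
      rw [← pow_add, ← pow_add]; congr 1; omega]
    ring
  have hd := hasSum_sum (s := Finset.univ) fun i (_ : i ∈ Finset.univ) => hJ i i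
  have hall := (hd.sub hq).add hc
  have hzero := hall.unique (hasSum_zero.congr_fun fun s => ?_)
  · rw [hX, Matrix.det_fin_three]
    rw [minorSum_eq, detMix_eq, Fin.sum_univ_three] at hzero
    simp
    linear_combination hzero
  · rcases s.eq_zero_or_pos with rfl | hs
    · simp [hj0, tripleSum]
    · have h5 : ∑ i, jac (ξ s) a i i = ∑ m ∈ Finset.Ioo 0 s, minorSum (ξ m) (ξ (s - m)) a
          - tripleSum s fun l m n => detMix (ξ l) (ξ m) (ξ n) a := h.div_eq s hs a
      rw [← Finset.mul_sum, h5]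
      ring

lemma isCauchySolution_lagrangianMap (hv : IsInitialVelocity v) (h : IsTaylorCoefficients v ξ)
    (hA : IsMajorant Γ A) (hΓ : 0 ≤ Γ) (hξ : ∀ s, Good (ξ s) (A s)) :
    IsCauchySolution v {t : ℝ | |t| * Γ < improvedCriticalTime} (lagrangianMap ξ) := by
  have hvel : ∀ t : ℝ, |t| * Γ < improvedCriticalTime →
      timeDeriv (lagrangianMap ξ) t = weightedSum ξ fun s => s * t ^ (s - 1) := fun t ht =>
    funext fun a => (hasDerivAt_lagrangianMap hA hΓ hξ ht a).deriv
  have h0 : |(0 : ℝ)| * Γ < improvedCriticalTime := by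
    have := improvedCriticalTime_bounds.1
    rw [abs_zero, zero_mul]
    linarith
  refine ⟨fun a => ?_, fun a => ?_, fun t ht a => ?_, fun t ht => ?_, fun t ht => ?_,
    fun t ht a => ?_, fun t ht a => ?_⟩
  · rw [lagrangianMap, tsum_eq_single 0 fun s hs => by rw [zero_pow hs, zero_smul], h.zero]
    simp
  · rw [hvel 0 h0, weightedSum, tsum_eq_single 1, h.one_eq hv]
    · simp
    · intro s hs
      -- At `s = 0` the truncated exponent is 0, so the power is 1 and it is the factor `s` that
      -- vanishes.
      rcases s.eq_zero_or_pos with rfl | hs'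
      · simp
      · rw [zero_pow (by omega), mul_zero, zero_smul]
  · exact (hasDerivAt_lagrangianMap hA hΓ hξ ht a).differentiableAt
  · have : (fun a => lagrangianMap ξ t a - a) = weightedSum ξ fun s => t ^ s := by
      funext a
      rw [lagrangianMap, add_sub_cancel_left]
      rfl
    rw [this]
    exact weightedSum_isPeriodicField hξ (summable_weight hA hΓ ht)
  · rw [hvel t ht]
    exact (weightedSum_contDiff hξ (summable_weight_deriv hA hΓ ht)).1
  · rw [hvel t ht]
    exact gradCross_lagrangianMap h hA hΓ hξ ht a
  · exact det_lagrangianMap h hA hΓ hξ ht a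

lemma norm_complexify (u : E3) : ‖complexify u‖ = ‖u‖ := by
  rw [EuclideanSpace.norm_eq, EuclideanSpace.norm_eq]
  simp [complexify]

lemma le_radius_timeTaylorSeries (hA : IsMajorant Γ A) (hΓ : 0 ≤ Γ) (hξ : ∀ s, Good (ξ s) (A s))
    (a : E3) : ENNReal.ofReal improvedCriticalTime / ENNReal.ofReal Γ
      ≤ (timeTaylorSeries ξ a).radius := by
  have hT : 0 < improvedCriticalTime := by
    have := improvedCriticalTime_bounds.1
    linarith
  refine ENNReal.le_of_forall_nnreal_lt fun r hr => ?_
  have hr' : (r : ℝ) * Γ ≤ improvedCriticalTime := by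
    -- For `Γ = 0` the quotient is infinite and every `r` is admissible.
    rcases hΓ.eq_or_lt with h0 | h0
    · rw [← h0, mul_zero]
      exact hT.le
    · rw [← ENNReal.ofReal_div_of_pos h0, ← ENNReal.ofReal_coe_nnreal,
        ENNReal.ofReal_lt_ofReal_iff (by positivity), lt_div_iff₀ h0] at hr
      exact hr.le
  have hs := hA.summable hΓ r.2 hr'
  refine FormalMultilinearSeries.le_radius_of_bound _ (∑' s, A s * (r : ℝ) ^ s) fun s => ?_
  rw [timeTaylorSeries, ContinuousMultilinearMap.norm_mkPiRing, norm_complexify]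
  refine (mul_le_mul_of_nonneg_right ((hξ s).norm_le a) (by positivity)).trans ?_
  exact hs.le_tsum s fun n _ => mul_nonneg (hA.nonneg hΓ n) (pow_nonneg r.2 n)

/-- Nonnegative terms may be summed first over the frequencies, where `A s` bounds the sum, and then
over the orders. -/
lemma summable_generating (hA : IsMajorant Γ A) (hΓ : 0 ≤ Γ) {c : ℕ → Wave → C3}
    (hc : ∀ s, Summable fun p : Wave => p.length * ‖c s p‖)
    (hcA : ∀ s, ∑' p : Wave, p.length * ‖c s p‖ ≤ A s) (ht0 : 0 ≤ t)
    (ht : t * Γ < improvedCriticalTime) :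
    Summable fun q : ℕ × Wave => q.2.length * ‖c q.1 q.2‖ * t ^ q.1 := by
  have hnn : ∀ s (p : Wave), 0 ≤ p.length * ‖c s p‖ * t ^ s := fun s p =>
    mul_nonneg (mul_nonneg p.length_nonneg (norm_nonneg _)) (pow_nonneg ht0 s)
  have hfib : ∀ s, Summable fun p : Wave => p.length * ‖c s p‖ * t ^ s := fun s =>
    (hc s).mul_right (t ^ s)
  have hsum : Summable fun s => ∑' p : Wave, p.length * ‖c s p‖ * t ^ s := by
    refine Summable.of_nonneg_of_le (fun s => tsum_nonneg (hnn s)) (fun s => ?_)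
      (hA.summable hΓ ht0 ht.le)
    rw [tsum_mul_right]
    exact mul_le_mul_of_nonneg_right (hcA s) (pow_nonneg ht0 s)
  have h := summable_prod_of_nonneg
    (f := fun q : ℕ × Wave => q.2.length * ‖c q.1 q.2‖ * t ^ q.1) fun q => hnn q.1 q.2
  exact h.mpr ⟨hfib, hsum⟩

end Solution

end CauchySolution

end LagrangianEuler

end

theorem mainTheorem6 :
    (∀ (v : LagrangianEuler.E3 → LagrangianEuler.E3)
        (ω : LagrangianEuler.Wave → LagrangianEuler.C3) (Γ : ℝ),
      LagrangianEuler.IsInitialVelocity v →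
      LagrangianEuler.HasAbsFourierSeries (LagrangianEuler.curl v) ω →
      Γ = ∑' p, ‖ω p‖ →
      ∃ (ξ : ℕ → LagrangianEuler.E3 → LagrangianEuler.E3)
        (ξhat : ℕ → LagrangianEuler.Wave → LagrangianEuler.C3),
        -- the time-Taylor coefficients exist and are unique
        LagrangianEuler.IsTaylorCoefficients v ξ ∧
        (∀ ξ', LagrangianEuler.IsTaylorCoefficients v ξ' → ξ' = ξ) ∧
        (∀ s, LagrangianEuler.HasAbsFourierSeries (ξ s) (ξhat s)) ∧
        -- the radius of convergence is at least the new critical time divided by Γ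
        (∀ a, ENNReal.ofReal LagrangianEuler.improvedCriticalTime / ENNReal.ofReal Γ ≤
          (LagrangianEuler.timeTaylorSeries ξ a).radius) ∧
        -- the generating function is finite
        (∀ t : ℝ, 0 ≤ t → t * Γ < LagrangianEuler.improvedCriticalTime →
          Summable (fun q : ℕ × LagrangianEuler.Wave =>
            q.2.length * ‖ξhat q.1 q.2‖ * t ^ q.1)) ∧
        -- the sum of the series solves Cauchy's Lagrangian equations
        LagrangianEuler.IsCauchySolution v
          {t : ℝ | |t| * Γ < LagrangianEuler.improvedCriticalTime}
          (LagrangianEuler.lagrangianMap ξ)) ∧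
    -- the value of the new critical time and its comparison with the old one
    LagrangianEuler.improvedCriticalTime
        + (1 / 2 - 1 / Real.sqrt 2) * LagrangianEuler.improvedCriticalTime ^ 2
      = LagrangianEuler.criticalTime ∧
    |LagrangianEuler.improvedCriticalTime - 0.3325| < 0.00005 ∧
    |LagrangianEuler.criticalTime - 0.3096| < 0.00005 ∧
    |LagrangianEuler.improvedCriticalTime / LagrangianEuler.criticalTime - 1.07| < 0.005 := by
  have hb := LagrangianEuler.improvedCriticalTime_bounds
  have hb' := LagrangianEuler.criticalTime_bounds
  refine ⟨?_, LagrangianEuler.improvedCriticalTime_eq, ?_, ?_, ?_⟩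
  · intro v ω Γ hv hω hΓ
    have hgood := hv.good hω
    rw [← hΓ] at hgood
    have hΓ0 : 0 ≤ Γ := hgood.nonneg
    obtain ⟨A, hA⟩ := LagrangianEuler.exists_majorant Γ
    obtain ⟨ξ, hξ, hξA⟩ := LagrangianEuler.exists_isTaylorCoefficients hgood hv.div_eq_zero hA
    -- The Fourier coefficients are extracted explicitly because the generating function refers to
    -- them.
    choose c hc hc0 hc1 hcA using hξA
    have hξA : ∀ s, LagrangianEuler.Good (ξ s) (A s) := fun s =>
      ⟨c s, hc s, hc0 s, hc1 s, hcA s⟩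
    exact ⟨ξ, c, hξ, fun η hη => hη.unique hξ, hc,
      LagrangianEuler.le_radius_timeTaylorSeries hA hΓ0 hξA,
      fun t ht0 ht => LagrangianEuler.summable_generating hA hΓ0 hc1 hcA ht0 ht,
      LagrangianEuler.isCauchySolution_lagrangianMap hv hξ hA hΓ0 hξA⟩
  · rw [abs_lt]
    constructor <;> linarith
  · rw [abs_lt]
    constructor <;> linarith
  · have hpos : 0 < LagrangianEuler.criticalTime := by linarith
    rw [abs_lt, lt_sub_iff_add_lt, sub_lt_iff_lt_add, lt_div_iff₀ hpos, div_lt_iff₀ hpos]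
    constructor <;> linarith
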